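/- Let $p$ be a prime number, $S$ a scheme, $M$ an invertible sheaf on $S$, and let $\lambda\in\Gamma(S,M^{-1})$ and $\mu\in\Gamma(S,M^{\otimes(p-1)})$ satisfy $\lambda^{\otimes(p-1)}\otimes\mu=p\cdot 1_{\mathcal O_S}$. Let $\mathcal G^{(\lambda)}$ be the $S$-group scheme whose points with values in an $S$-scheme $T$ are the sections $u\in\Gamma(T,M\otimes\mathcal O_T)$ such that $1+\lambda\otimes u$ is invertible, with group law $u_1\star u_2=u_1+u_2+\lambda\otimes u_1\otimes u_2$, and let $\varphi:\mathcal G^{(\lambda)}\to\mathcal G^{(\lambda^{\otimes p})}$ be the homomorphism $$\varphi(u)=u^{\otimes p}+\sum_{i=1}^{p-1}\frac1p\binom pi\,\lambda^{\otimes(i-1)}\otimes\mu\otimes u^{\otimes i}.$$ Let $H^M_{\lambda,\mu}=\ker\varphi$ be the associated congruence group scheme. Then $H^M_{\lambda,\mu}$ exists as an $S$-group scheme, it is finite locally free of order $p$ over $S$, and $u\mapsto 1+\lambda\otimes u$ defines a morphism of $S$-group schemes $\kappa:H^M_{\lambda,\mu}\to\mu_{p,S}$ which is a cogenerator. That is,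 the Cartier dual morphism $\gamma:(\mathbb Z/p\mathbb Z)_S\to (H^M_{\lambda,\mu})^\vee$ is a (Katz–Mazur) generator: for every affine $S$-scheme $\operatorname{Spec}R$ and every function $f$ on $(H^M_{\lambda,\mu})^\vee\times_S\operatorname{Spec}R$, the norm of $f$ over $R$ equals $\prod_{i=0}^{p-1}f(\gamma(i))$. -/

import Mathlib

open CategoryTheory Limits Opposite AlgebraicGeometry
open scoped TensorProduct

universe u

noncomputable section

namespace CongruenceGroup

/-! ### Full sets of sections -/

/-- `n` is the norm of the element `b` of the finite locally free `R`-algebra `B`: over every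
`R`-algebra `R'` over which `B` becomes free, `n` maps to the determinant of multiplication by `b`.
(`Algebra.norm` is the determinant of multiplication, and is only meaningful for free algebras.
A finite locally free algebra is free over the members of an affine open cover of `Spec R`, so
this determines `n`.) -/
def IsNorm (R B : Type u) [CommRing R] [Ring B] [Algebra R B] (b : B) (n : R) : Prop :=
  ∀ (R' : Type u) [CommRing R'] [Algebra R R'], Module.Free R' (R' ⊗[R] B) →
    algebraMap R R' n = Algebra.norm R' ((1 : R') ⊗ₜ[R] b)

/-- The sections `f ↦ x i f` of a finite locally free `R`-algebra `B` have the property that the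
norm of every `f : B` is the product of the values of `f` at the sections. -/
def NormIsProduct (R B : Type u) [CommRing R] [Ring B] [Algebra R B]
    {I : Type} [Fintype I] (x : I → B →ₗ[R] R) : Prop :=
  ∀ f : B, IsNorm R B f (∏ i, x i f)

/-! ### Cartier duality over an affine base -/

/-- The algebra of the Cartier dual of `Spec A`: the `R`-linear dual of the Hopf algebra `A`, with
the (convolution) product dual to the comultiplication of `A`. -/
abbrev DualAlgebra (R A : Type u) [CommRing R] [CommRing A] [HopfAlgebra R A] : Type u :=
  WithConv (A →ₗ[R] R)

/-- Evaluation of elements of the dual algebra at `a : A`. If `a` is a character of `Spec A`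
(a group-like element) this is the section of the Cartier dual of `Spec A` defined by `a`. -/
def evalAt (R : Type u) {A : Type u} [CommRing R] [CommRing A] [HopfAlgebra R A] (a : A) :
    DualAlgebra R A →ₗ[R] R where
  toFun f := f.ofConv a
  map_add' _ _ := rfl
  map_smul' _ _ := rfl

/-- For a character (group-like element) `z` of the group scheme `Spec A` with `z ^ p = 1`, the
sections `f ↦ f (z ^ i)`, `0 ≤ i ≤ p - 1`, of the Cartier dual of `Spec A` satisfy the norm
condition. -/
def DualNormIsProduct (p : ℕ) (R A : Type u) [CommRing R] [CommRing A] [HopfAlgebra R A] (z : A) :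
    Prop :=
  NormIsProduct R (DualAlgebra R A) (fun i : Fin p ↦ evalAt R (z ^ (i : ℕ)))

/-! ### The group scheme `μ_p` and cogenerators -/

/-- The group scheme `μ_{p,S}`, through its functor of points `T ↦ {a ∈ Γ(T, 𝒪_T)ˣ | a ^ p = 1}`. -/
def muFunctor (p : ℕ) (S : Scheme.{u}) : (Over S)ᵒᵖ ⥤ GrpCat.{u} where
  obj T := GrpCat.of (rootsOfUnity p Γ(T.unop.left, ⊤))
  map f := GrpCat.ofHom (restrictRootsOfUnity f.unop.left.appTop.hom p)

/-- The function in `Γ(T, 𝒪_T)` which is the value of a homomorphism `κ : G ⟶ μ_{p,S}` at a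
`T`-point of `G`. -/
def muValue {p : ℕ} {S : Scheme.{u}} {G : Over S} [GrpObj G]
    (κ : yonedaGrpObj G ⟶ muFunctor p S) {T : Over S} (h : T ⟶ G) : Γ(T.left, ⊤) :=
  let z : rootsOfUnity p Γ(T.left, ⊤) := (κ.app (op T)).hom h
  ((z : Γ(T.left, ⊤)ˣ) : Γ(T.left, ⊤))

/-- `G` is finite locally free of order `p` over `S`. -/
structure IsFiniteLocallyFreeOfOrder (p : ℕ) (S G : Scheme.{u}) [G.Over S] : Prop where
  isFinite : IsFinite (G ↘ S)
  flat : Flat (G ↘ S)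
  locallyOfFinitePresentation : LocallyOfFinitePresentation (G ↘ S)
  finrank_eq : ∀ s : S, (G ↘ S).finrank s = p

/-- The base change of `G` along `g : Spec R ⟶ S`. -/
abbrev baseChange {S : Scheme.{u}} (G : Scheme.{u}) [G.Over S] {R : CommRingCat.{u}}
    (g : Spec R ⟶ S) : Scheme.{u} :=
  pullback (G ↘ S) g

/-- The projection of the base change to `G`, as a morphism of `S`-schemes, i.e. the tautological
point of `G` with values in `G ×_S Spec R`. -/
def baseChangePoint {S : Scheme.{u}} (G : Scheme.{u}) [G.Over S] {R : CommRingCat.{u}}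
    (g : Spec R ⟶ S) :
    Over.mk (pullback.fst (G ↘ S) g ≫ G ↘ S) ⟶ G.asOver S :=
  Over.homMk (pullback.fst (G ↘ S) g)

/-- The function on `G ×_S Spec R` which is the pullback under `κ : G ⟶ μ_{p,S}` of the standard
coordinate of `μ_p`. -/
def coordinate {p : ℕ} {S G : Scheme.{u}} [G.Over S] [GrpObj (G.asOver S)]
    (κ : yonedaGrpObj (G.asOver S) ⟶ muFunctor p S) {R : CommRingCat.{u}} (g : Spec R ⟶ S) :
    Γ(baseChange G g, ⊤) :=
  muValue κ (baseChangePoint G g)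

/-- A finite group scheme becomes affine over an affine base. -/
lemma isAffine_baseChange {p : ℕ} {S G : Scheme.{u}} [G.Over S]
    (hG : IsFiniteLocallyFreeOfOrder p S G) {R : CommRingCat.{u}} (g : Spec R ⟶ S) :
    IsAffine (baseChange G g) :=
  haveI := hG.isFinite
  isAffine_of_isAffineHom (pullback.snd (G ↘ S) g)

/-- A morphism of `S`-group schemes `κ : G ⟶ μ_{p,S}` is a *cogenerator* if `G` is finite locally
free of order `p` and the Cartier dual morphism `γ : (ℤ/p)_S ⟶ G^∨` is a generator, i.e. the
sections `γ(i)` are a full set of sections of `G^∨`: for every affine `S`-scheme `Spec R` and every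
function `f` on `(G^∨)_R`, the norm of `f` is `∏ i, f (γ(i))`.

Here `(G^∨)_R` is the spectrum of the dual of the Hopf algebra `A = Γ(G_R, ⊤)`, and `γ(i)` is the
character `z ^ i` of `G_R`, where `z : A` is the pullback by `κ` of the coordinate of `μ_p`. -/
structure IsCogenerator (p : ℕ) {S G : Scheme.{u}} [G.Over S] [GrpObj (G.asOver S)]
    (κ : yonedaGrpObj (G.asOver S) ⟶ muFunctor p S) : Prop where
  isFiniteLocallyFree : IsFiniteLocallyFreeOfOrder p S G
  isFullSetOfSections : ∀ {R : CommRingCat.{u}} (g : Spec R ⟶ S),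
    haveI : IsAffine (baseChange G g) := isAffine_baseChange isFiniteLocallyFree g
    DualNormIsProduct p R Γ(baseChange G g, ⊤) (coordinate κ g)

/-! ### Invertible sheaves and triples -/

/-- An `𝒪_S`-module `L` is invertible: `S` is covered by open subsets `U` with a section
`e ∈ Γ(L, U)` such that `a ↦ a • e` is an isomorphism `𝒪_U ≅ L|_U`. -/
def IsInvertible {S : Scheme.{u}} (L : S.Modules) : Prop :=
  ∀ s : S, ∃ (U : S.Opens) (_ : s ∈ U) (e : Γ(L, U)), ∀ (V : S.Opens) (i : V ⟶ U),
    Function.Bijective fun a : Γ(S, V) ↦ a • (L.presheaf.map i.op e : Γ(L, V))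

/-- A morphism of `𝒪_S`-modules `L^{⊗ n} → 𝒪_S`, given by its values on local sections of `L`.
For `L` the inverse of an invertible sheaf `M`, this is a global section of `M^{⊗ n}`. -/
structure TensorForm {S : Scheme.{u}} (L : S.Modules) (n : ℕ) where
  app : ∀ U : S.Opens, MultilinearMap Γ(S, U) (fun _ : Fin n ↦ Γ(L, U)) Γ(S, U)
  map_app : ∀ {V U : S.Opens} (i : V ⟶ U) (ξ : Fin n → Γ(L, U)),
    app V (fun j ↦ L.presheaf.map i.op (ξ j)) = S.presheaf.map i.op (app U ξ)

/-- A triple `(M, λ, μ)` over `S`: an invertible sheaf `M` with `λ ∈ Γ(S, M⁻¹)`,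
`μ ∈ Γ(S, M^{⊗ (p - 1)})` such that `λ^{⊗ (p - 1)} ⊗ μ = p`. The invertible sheaf `M` is recorded
by its inverse `L = M⁻¹`; so a section of `M^{⊗ n}` is a morphism `L^{⊗ n} → 𝒪_S`. -/
structure Triple (p : ℕ) (S : Scheme.{u}) where
  L : S.Modules
  isInvertible : IsInvertible L
  lam : Γ(L, ⊤)
  mu : TensorForm L (p - 1)
  mu_lam : mu.app ⊤ (fun _ ↦ lam) = (p : Γ(S, ⊤))

/-- A `T`-point of the line bundle `𝕍(M) = Spec Sym(M⁻¹)` with `M⁻¹ = L`, i.e. a global section `u`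
of the pullback of `M` to the `S`-scheme `f : T ⟶ S`: an `𝒪_S`-linear morphism `L → f_* 𝒪_T`. -/
@[ext]
structure LinePoint {S : Scheme.{u}} (L : S.Modules) (T : Over S) where
  app : ∀ U : S.Opens, Γ(L, U) →+ Γ(T.left, T.hom ⁻¹ᵁ U)
  app_smul : ∀ (U : S.Opens) (r : Γ(S, U)) (ξ : Γ(L, U)),
    app U (r • ξ) = T.hom.app U r * app U ξ
  app_map : ∀ {V U : S.Opens} (i : V ⟶ U) (ξ : Γ(L, U)),
    app V (L.presheaf.map i.op ξ) =
      T.left.presheaf.map ((TopologicalSpace.Opens.map T.hom.base).map i).op (app U ξ)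

lemma preimage_le {S : Scheme.{u}} {T T' : Over S} (a : T' ⟶ T) (U : S.Opens) :
    T'.hom ⁻¹ᵁ U ≤ a.left ⁻¹ᵁ (T.hom ⁻¹ᵁ U) := by
  rw [← Scheme.Hom.comp_preimage, Over.w a]

lemma app_comp_appLE {S T T' : Scheme.{u}} (a : T' ⟶ T) (f : T ⟶ S) (f' : T' ⟶ S)
    (w : a ≫ f = f') (U : S.Opens) (e : f' ⁻¹ᵁ U ≤ a ⁻¹ᵁ (f ⁻¹ᵁ U)) :
    f.app U ≫ a.appLE (f ⁻¹ᵁ U) (f' ⁻¹ᵁ U) e = f'.app U := by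
  subst w
  exact (Scheme.Hom.comp_appLE a f U _ le_rfl).symm.trans (a ≫ f).appLE_eq_app

/-- Pullback of a `T`-point of `𝕍(M)` along a morphism `a : T' ⟶ T` of `S`-schemes. -/
def LinePoint.pullback {S : Scheme.{u}} {L : S.Modules} {T T' : Over S} (u : LinePoint L T)
    (a : T' ⟶ T) : LinePoint L T' where
  app U := (a.left.appLE (T.hom ⁻¹ᵁ U) (T'.hom ⁻¹ᵁ U)
    (preimage_le a U)).hom.toAddMonoidHom.comp (u.app U)
  app_smul U r ξ := by
    have h : T.hom.app U ≫ a.left.appLE (T.hom ⁻¹ᵁ U) (T'.hom ⁻¹ᵁ U) (preimage_le a U) =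
        T'.hom.app U := app_comp_appLE a.left T.hom T'.hom (Over.w a) U (preimage_le a U)
    rw [← h]
    simp [u.app_smul]
  app_map {V U} i ξ := by
    have h : T.left.presheaf.map ((TopologicalSpace.Opens.map T.hom.base).map i).op ≫
        a.left.appLE (T.hom ⁻¹ᵁ V) (T'.hom ⁻¹ᵁ V) (preimage_le a V) =
        a.left.appLE (T.hom ⁻¹ᵁ U) (T'.hom ⁻¹ᵁ U) (preimage_le a U) ≫
        T'.left.presheaf.map ((TopologicalSpace.Opens.map T'.hom.base).map i).op := by
      rw [Scheme.Hom.map_appLE, Scheme.Hom.appLE_map]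
    have h' := ConcreteCategory.congr_hom h (u.app U ξ)
    rw [ConcreteCategory.comp_apply, ConcreteCategory.comp_apply] at h'
    rw [AddMonoidHom.comp_apply, u.app_map]
    exact h'

namespace Triple

variable {p : ℕ} {S : Scheme.{u}} (X : Triple p S) {T : Over S}

/-- The function `λ ⊗ u` on the preimage in `T` of an open subset `U` of `S`. -/
def lamMul (u : LinePoint X.L T) (U : S.Opens) : Γ(T.left, T.hom ⁻¹ᵁ U) :=
  u.app U (X.L.presheaf.map (homOfLE le_top : U ⟶ ⊤).op X.lam)

lemma lamMul_map (u : LinePoint X.L T) {V U : S.Opens} (i : V ⟶ U) :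
    X.lamMul u V =
      T.left.presheaf.map ((TopologicalSpace.Opens.map T.hom.base).map i).op (X.lamMul u U) := by
  rw [lamMul, lamMul, ← u.app_map, ← ConcreteCategory.comp_apply, ← Functor.map_comp]
  rfl

/-- The function `1 + λ ⊗ u` on `T`. -/
def oneAdd (u : LinePoint X.L T) : Γ(T.left, ⊤) :=
  1 + (show Γ(T.left, ⊤) from u.app ⊤ X.lam)

/-- The multiplication `u ⋆ v = u + v + λ ⊗ u ⊗ v`. -/
def star (u v : LinePoint X.L T) : LinePoint X.L T where
  app U := u.app U + v.app U + (AddMonoidHom.mulLeft (X.lamMul u U)).comp (v.app U)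
  app_smul U r ξ := by
    simp only [AddMonoidHom.add_apply, AddMonoidHom.comp_apply, AddMonoidHom.coe_mulLeft,
      u.app_smul, v.app_smul]
    ring
  app_map i ξ := by
    simp only [AddMonoidHom.add_apply, AddMonoidHom.comp_apply, AddMonoidHom.coe_mulLeft,
      u.app_map, v.app_map, X.lamMul_map u i, map_add, map_mul]

/-- The section `φ(u) = u^{⊗ p} + ∑_{1 ≤ i ≤ p - 1} (1 / p) (p choose i) λ^{⊗ (i - 1)} ⊗ μ ⊗ u^{⊗ i}`
of the pullback of `M^{⊗ p}` to `T`, evaluated at the local section `ξ_1 ⊗ ⋯ ⊗ ξ_{p - 1} ⊗ ζ` of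
`L^{⊗ p}`. -/
def phi (u : LinePoint X.L T) (U : S.Opens) (ξ : Fin (p - 1) → Γ(X.L, U)) (ζ : Γ(X.L, U)) :
    Γ(T.left, T.hom ⁻¹ᵁ U) :=
  (∏ j, u.app U (ξ j)) * u.app U ζ +
    ∑ i ∈ Finset.Icc 1 (p - 1), ((p.choose i / p : ℕ) : Γ(T.left, T.hom ⁻¹ᵁ U)) *
      X.lamMul u U ^ (i - 1) * T.hom.app U (X.mu.app U ξ) * u.app U ζ

/-- `u` is a `T`-point of the kernel of `φ` on the group scheme `𝒢^{(λ)}`: `1 + λ ⊗ u` is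
invertible and `φ(u) = 0`. -/
def IsKernelPoint (u : LinePoint X.L T) : Prop :=
  IsUnit (X.oneAdd u) ∧ ∀ U ξ ζ, X.phi u U ξ ζ = 0

open scoped MonObj in
/-- The structure on an `S`-group scheme `H` of a congruence group scheme associated to
`(M, λ, μ)`, i.e. of a kernel of `φ` in `𝒢^{(λ)}`: functorially in the `S`-scheme `T`, the group
`H(T)` is identified with the set of `u` such that `1 + λ ⊗ u` is invertible and `φ(u) = 0`, with the
multiplication `⋆`. By the Yoneda lemma this determines `H` up to unique isomorphism. -/
structure CongruenceGroupScheme (H : Scheme.{u}) [H.Over S] [GrpObj (H.asOver S)] where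
  points : ∀ T : Over S, (T ⟶ H.asOver S) ≃ {u : LinePoint X.L T // X.IsKernelPoint u}
  points_comp : ∀ {T T' : Over S} (a : T' ⟶ T) (h : T ⟶ H.asOver S),
    (points T' (a ≫ h)).1 = (points T h).1.pullback a
  points_mul : ∀ {T : Over S} (h h' : T ⟶ H.asOver S),
    (points T (h * h')).1 = X.star (points T h).1 (points T h').1

end Triple

end CongruenceGroup

end

-- Where M is trivial, λ and μ become functions ℓ and m with ℓ^(p-1) m = p, and the kernel of φ is
-- the scheme of roots of a monic polynomial φ(x) of degree p. The functor of kernel points is a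
-- Zariski sheaf covered by these open charts, hence representable
-- (`isRepresentable_absoluteFunctor`). Finiteness, flatness and rank p are read off on the charts.
--
-- The group structure rests on (1 + ℓx)^p = 1 + ℓ^p φ(x) (`one_add_mul_pow_eq`). In the universal
-- ring ℓ can be cancelled, so φ is a homomorphism there and, by specialization, everywhere
-- (`congrForm_star`). A coordinate-free variant (`one_add_lamMul_pow`) gives (1 + λ ⊗ u)^p = 1 on
-- the kernel. Invertibility is then automatic, inverses are explicit, and κ lands in μ_p.
--
-- For the norm condition, let A be the Hopf algebra of the kernel over R. Multiplication by f on
-- the dual of A is the transpose of the translation a ↦ ∑ f(a₁) a₂ on A (`norm_dualAlgebra`), so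
-- both have the same determinant. Locally 1, x, ..., x^(p-1) is a basis of A, and with z = 1 + ℓx
-- the group law reads Δx = z ⊗ x + x ⊗ 1. The binomial theorem makes translation triangular in this
-- basis, with diagonal entries f(z^i), whence the norm is ∏ f(z^i)
-- (`HasCoordinate.det_translation`). This equality of elements of the base is checked on
-- localizations (`dualNormIsProduct_of_local`).

universe v

noncomputable section

namespace CongruenceGroup

/-! ### Norms on dual algebras -/

section DualBaseChange

variable {R M : Type*} [CommRing R] [AddCommGroup M] [Module R M]
  (K : Type*) [CommRing K] [Algebra R K]

/-- Formation of the dual of a module commutes with base change, as a linear map. -/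
def dualBaseChange : K ⊗[R] Module.Dual R M →ₗ[K] Module.Dual K (K ⊗[R] M) :=
  TensorProduct.AlgebraTensorModule.lift
    ((LinearMap.toSpanSingleton K _ (Module.Dual.baseChange K)).restrictScalars K)

@[simp]
lemma dualBaseChange_tmul (c : K) (φ : Module.Dual R M) :
    dualBaseChange K (c ⊗ₜ φ) = c • φ.baseChange K := rfl

/-- A finite projective module has a dual basis: elements a_j and forms φ_j with m = ∑ φ_j(m) a_j.
It gives an explicit inverse, so no passage to local bases is needed. -/
lemma bijective_dualBaseChange [Module.Finite R M] [Module.Projective R M] :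
    Function.Bijective (dualBaseChange (R := R) (M := M) K) := by
  obtain ⟨n, f, g, -, -, hfg⟩ := Module.Finite.exists_comp_eq_id_of_projective R M
  let a : Fin n → M := fun j ↦ f (Pi.single j 1)
  let φ : Fin n → Module.Dual R M := fun j ↦ LinearMap.proj j ∘ₗ g
  have hsum (m : M) : ∑ j, φ j m • a j = m := by
    conv_rhs => rw [← LinearMap.id_apply (R := R) m, ← hfg, LinearMap.comp_apply,
      pi_eq_sum_univ' (g m), map_sum]
    refine Finset.sum_congr rfl fun j _ ↦ ?_
    rw [map_smul]
    simp only [φ, a, LinearMap.comp_apply, LinearMap.proj_apply]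
  have hsum' (ψ : Module.Dual R M) : ∑ j, ψ (a j) • φ j = ψ := by
    ext m
    conv_rhs => rw [← hsum m, map_sum]
    simp [mul_comm]
  constructor
  · let inv : Module.Dual K (K ⊗[R] M) →ₗ[K] K ⊗[R] Module.Dual R M :=
      ∑ j, (LinearMap.toSpanSingleton K _ ((1 : K) ⊗ₜ[R] φ j)) ∘ₗ
        (LinearMap.applyₗ ((1 : K) ⊗ₜ[R] a j))
    have h : inv ∘ₗ dualBaseChange K = LinearMap.id := by
      ext ψ
      conv_rhs => simp only [TensorProduct.AlgebraTensorModule.curry_apply, LinearMap.id_apply,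
        LinearMap.restrictScalars_self, TensorProduct.curry_apply]; rw [← hsum' ψ]
      simp [inv, TensorProduct.tmul_sum, TensorProduct.smul_tmul']
    exact Function.LeftInverse.injective (g := inv) fun y ↦ LinearMap.congr_fun h y
  · intro ψ
    refine ⟨∑ j, ψ ((1 : K) ⊗ₜ[R] a j) ⊗ₜ φ j, ?_⟩
    ext m
    conv_rhs => simp only [TensorProduct.AlgebraTensorModule.curry_apply,
        LinearMap.restrictScalars_self, TensorProduct.curry_apply]; rw [← hsum m]
    have (j : Fin n) : (1 : K) ⊗ₜ[R] (φ j m • a j) =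
        (algebraMap R K (φ j m)) • ((1 : K) ⊗ₜ[R] a j) := by
      rw [← TensorProduct.smul_tmul, TensorProduct.smul_tmul', Algebra.smul_def, smul_eq_mul]
    simp [TensorProduct.tmul_sum, this, mul_comm, Algebra.smul_def]

/-- Formation of the dual of a finite projective module commutes with base change. -/
def dualBaseChangeEquiv [Module.Finite R M] [Module.Projective R M] :
    K ⊗[R] Module.Dual R M ≃ₗ[K] Module.Dual K (K ⊗[R] M) :=
  .ofBijective _ (bijective_dualBaseChange K)

/-- A map of free modules and its transpose have the same determinant; conjugation by
`dualBaseChangeEquiv` exchanges transposition and base change. -/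
lemma det_baseChange_dualMap [Module.Finite R M] [Module.Projective R M]
    [Module.Free K (K ⊗[R] M)] (T : M →ₗ[R] M) :
    LinearMap.det (T.dualMap.baseChange K) = LinearMap.det (T.baseChange K) := by
  rw [← LinearMap.det_dualMap (T.baseChange K), ← LinearMap.det_conj _ (dualBaseChangeEquiv K)]
  congr 1
  rw [← LinearMap.comp_assoc, LinearEquiv.comp_toLinearMap_symm_eq]
  ext φ m
  simp [dualBaseChangeEquiv]

end DualBaseChange

/-! ### Translation operators on a bialgebra. -/

section Translation

variable {R A : Type*} [CommRing R] [CommRing A] [Bialgebra R A]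

/-- Contraction of the first tensor factor with a linear form. -/
def contract (f : A →ₗ[R] R) : A ⊗[R] A →ₗ[R] A :=
  (TensorProduct.lid R A).toLinearMap ∘ₗ f.rTensor A

/-- The operator `a ↦ ∑ f(a₁) a₂`. -/
def translation (f : A →ₗ[R] R) : A →ₗ[R] A :=
  contract f ∘ₗ Coalgebra.comul

variable {K : Type*} [CommRing K] [Algebra R K]

/-- Pure tensors are written here as products of images of the two factors, the form in which powers
of Δx expand. -/
lemma baseChange_contract (f : A →ₗ[R] R) (y w : K ⊗[R] A) :
    (contract f).baseChange K
      (Algebra.TensorProduct.map (AlgHom.id K K) Algebra.TensorProduct.includeLeft y *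
        Algebra.TensorProduct.map (AlgHom.id K K) Algebra.TensorProduct.includeRight w) =
      Module.Dual.baseChange K f y • w := by
  induction y with
  | zero => simp
  | add y₁ y₂ h₁ h₂ => simp only [map_add, add_mul, h₁, h₂, add_smul]
  | tmul c a =>
    induction w with
    | zero => simp
    | add w₁ w₂ h₁ h₂ => simp only [map_add, mul_add, h₁, h₂, smul_add]
    | tmul d b =>
      simp [contract, TensorProduct.smul_tmul', TensorProduct.tmul_smul]

variable (R K) in
/-- After base change to `K`, the powers `1, x, ..., x ^ (p - 1)` of some `x` form a basis of `A`,
and `x` satisfies `z = 1 + ℓ x` and `Δ x = x ⊗ 1 + 1 ⊗ x + ℓ x ⊗ x`. -/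
def HasCoordinate (p : ℕ) (z : A) : Prop :=
  ∃ (l : K) (x : K ⊗[R] A) (b : Module.Basis (Fin p) K (K ⊗[R] A)),
    (∀ i, b i = x ^ (i : ℕ)) ∧ (1 : K) ⊗ₜ[R] z = 1 + l • x ∧
    Algebra.TensorProduct.map (AlgHom.id K K) (Bialgebra.comulAlgHom R A) x =
      Algebra.TensorProduct.map (AlgHom.id K K) Algebra.TensorProduct.includeLeft x +
      Algebra.TensorProduct.map (AlgHom.id K K) Algebra.TensorProduct.includeRight x +
      l • (Algebra.TensorProduct.map (AlgHom.id K K) Algebra.TensorProduct.includeLeft x *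
      Algebra.TensorProduct.map (AlgHom.id K K) Algebra.TensorProduct.includeRight x)

/-- In the basis of powers of a coordinate, translations are triangular, with the values at powers
of `z` on the diagonal. -/
lemma HasCoordinate.det_translation {p : ℕ} {z : A} (h : HasCoordinate R K p z) (f : A →ₗ[R] R) :
    LinearMap.det ((translation f).baseChange K) =
      algebraMap R K (∏ i : Fin p, f (z ^ (i : ℕ))) := by
  obtain ⟨l, x, b, hb, hz, hx⟩ := h
  set F := Module.Dual.baseChange K f with hF
  set j₁ : K ⊗[R] A →ₐ[K] K ⊗[R] (A ⊗[R] A) :=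
    Algebra.TensorProduct.map (AlgHom.id K K) Algebra.TensorProduct.includeLeft with hj₁
  set j₂ : K ⊗[R] A →ₐ[K] K ⊗[R] (A ⊗[R] A) :=
    Algebra.TensorProduct.map (AlgHom.id K K) Algebra.TensorProduct.includeRight with hj₂
  set D : K ⊗[R] A →ₐ[K] K ⊗[R] (A ⊗[R] A) :=
    Algebra.TensorProduct.map (AlgHom.id K K) (Bialgebra.comulAlgHom R A) with hD
  -- Substituting z = 1 + ℓx turns the formula for Δx into z ⊗ x + x ⊗ 1, a sum of two terms to
  -- which the binomial theorem applies.
  have hDx : D x = j₁ (1 ⊗ₜ z) * j₂ x + j₁ x := by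
    rw [hx, hz, map_add, map_one, map_smul, add_mul, one_mul, smul_mul_assoc]; ring
  have hT (y : K ⊗[R] A) : (translation f).baseChange K y = (contract f).baseChange K (D y) := by
    rw [translation, LinearMap.baseChange_comp]
    rfl
  have hpow (k : ℕ) : (translation f).baseChange K (x ^ k) =
      ∑ m ∈ Finset.range (k + 1), (k.choose m * F ((1 ⊗ₜ z) ^ m * x ^ (k - m))) • x ^ m := by
    rw [hT, map_pow, hDx, add_pow, map_sum]
    refine Finset.sum_congr rfl fun m _ ↦ ?_
    have : (j₁ (1 ⊗ₜ z) * j₂ x) ^ m * j₁ x ^ (k - m) * (k.choose m : K ⊗[R] (A ⊗[R] A)) =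
        j₁ ((k.choose m : K) • ((1 ⊗ₜ z) ^ m * x ^ (k - m))) * j₂ (x ^ m) := by
      rw [Algebra.smul_def, map_natCast]
      simp only [map_mul, map_pow, map_natCast]
      ring
    rw [this, baseChange_contract, map_smul, smul_eq_mul]
  -- Only powers x^m with m ≤ k occur in the image of x^k, and the coefficient at m = k is F(z^k).
  have hmat (i k : Fin p) : LinearMap.toMatrix b b ((translation f).baseChange K) i k =
      if i ≤ k then (k : ℕ).choose i * F ((1 ⊗ₜ z) ^ (i : ℕ) * x ^ ((k : ℕ) - i)) else 0 := by
    rw [LinearMap.toMatrix_apply, hb, hpow, map_sum, Finset.sum_apply']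
    have hrep (m : ℕ) (hm : m ∈ Finset.range (k + 1)) :
        b.repr ((((k : ℕ).choose m : K) * F ((1 ⊗ₜ z) ^ m * x ^ ((k : ℕ) - m))) • x ^ m) i =
          if m = i then ((k : ℕ).choose i : K) * F ((1 ⊗ₜ z) ^ (i : ℕ) * x ^ ((k : ℕ) - i))
            else 0 := by
      have hmp : m < p := by have := Finset.mem_range.1 hm; omega
      rw [show x ^ m = b ⟨m, hmp⟩ from (hb ⟨m, hmp⟩).symm, map_smul, b.repr_self,
        Finsupp.smul_apply, Finsupp.single_apply]
      simp only [Fin.ext_iff, smul_eq_mul]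
      split_ifs with h
      · subst h; simp
      · simp
    rw [Finset.sum_congr rfl hrep, Finset.sum_ite_eq' ]
    simp only [Finset.mem_range, Nat.lt_succ_iff, Fin.le_def]
  rw [← LinearMap.det_toMatrix b, Matrix.det_of_isUpperTriangular, map_prod]
  · refine Finset.prod_congr rfl fun i _ ↦ ?_
    rw [hmat, if_pos le_rfl]
    simp [hF, Algebra.smul_def]
  · intro i k hik
    rw [hmat, if_neg (not_le.2 (by exact hik))]

end Translation

/-! ### Descent of the norm identity from localizations. -/

section Local

lemma algebraMap_det_baseChange {R M : Type*} [CommRing R] [AddCommGroup M] [Module R M]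
    [Module.Finite R M] (K K' : Type*) [CommRing K] [Algebra R K] [CommRing K'] [Algebra R K']
    [Algebra K K'] [IsScalarTower R K K'] [Module.Free K (K ⊗[R] M)] (T : M →ₗ[R] M) :
    algebraMap K K' (LinearMap.det (T.baseChange K)) = LinearMap.det (T.baseChange K') := by
  rw [← LinearMap.det_baseChange, ← LinearMap.det_conj _
    (TensorProduct.AlgebraTensorModule.cancelBaseChange R K K' K' M)]
  congr 1
  rw [← LinearMap.comp_assoc, LinearEquiv.comp_toLinearMap_symm_eq]
  ext
  simp

variable {R A : Type u} [CommRing R] [CommRing A] [HopfAlgebra R A]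

/-- Convolution is (f * g)(a) = ∑ f(a₁) g(a₂) = g(∑ f(a₁) a₂), so left multiplication by f is the
transpose of translation by f. -/
lemma norm_dualAlgebra (f : DualAlgebra R A) (K : Type*) [CommRing K] [Algebra R K] :
    Algebra.norm K ((1 : K) ⊗ₜ[R] f) =
      LinearMap.det ((translation f.ofConv).dualMap.baseChange K) := by
  rw [Algebra.norm_apply, ← LinearMap.det_conj _
    ((WithConv.linearEquiv R (A →ₗ[R] R)).baseChange R K _ _)]
  congr 1
  rw [← LinearMap.comp_assoc, LinearEquiv.comp_toLinearMap_symm_eq]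
  ext g
  have h : (f * g).ofConv = (translation f.ofConv).dualMap g.ofConv := by
    rw [LinearMap.convMul_def, WithConv.ofConv_toConv, LinearMap.dualMap_apply', translation,
      ← LinearMap.comp_assoc, ← LinearMap.comp_assoc]
    congr 1
    ext a b
    simp [contract]
  simp [h]

/-- The images of `s` still generate the unit ideal of `R'`, so `R'` embeds in the product of the
corresponding localizations. -/
lemma eq_of_span_eq_top {R : Type*} [CommRing R] {s : Set R} (hs : Ideal.span s = ⊤)
    {R' : Type*} [CommRing R'] [Algebra R R'] {a b : R'}
    (h : ∀ r ∈ s, algebraMap R' (Localization.Away (algebraMap R R' r)) a =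
      algebraMap R' (Localization.Away (algebraMap R R' r)) b) : a = b := by
  have hs' : Ideal.span (algebraMap R R' '' s) = ⊤ := by
    rw [← Ideal.map_span, hs, Ideal.map_top]
  refine Localization.algebraMap_injective_of_span_eq_top _ hs' (funext ?_)
  rintro ⟨_, r, hr, rfl⟩
  exact h r hr

/-- The norm is taken over `R'`, while the coordinate lives over `K`. The dual is free over both
rings, so both determinants commute with passage to `K'`, where they are compared. -/
lemma algebraMap_norm_dualAlgebra {p : ℕ} [Module.Finite R A] [Module.Projective R A] {z : A}
    {K : Type*} [CommRing K] [Algebra R K] (h : HasCoordinate R K p z)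
    (R' K' : Type*) [CommRing R'] [Algebra R R'] [CommRing K'] [Algebra R K'] [Algebra R' K']
    [Algebra K K'] [IsScalarTower R R' K'] [IsScalarTower R K K']
    [Module.Free R' (R' ⊗[R] DualAlgebra R A)] (f : DualAlgebra R A) :
    algebraMap R' K' (Algebra.norm R' ((1 : R') ⊗ₜ[R] f)) =
      algebraMap R K' (∏ i : Fin p, f.ofConv (z ^ (i : ℕ))) := by
  have hfree : Module.Free R' (R' ⊗[R] Module.Dual R A) :=
    .of_equiv ((WithConv.linearEquiv R (A →ₗ[R] R)).baseChange R R' _ _)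
  have : Module.Free K (K ⊗[R] A) := by
    obtain ⟨l, x, b, -⟩ := h
    exact .of_basis b
  have : Module.Free K (K ⊗[R] Module.Dual R A) := .of_equiv (dualBaseChangeEquiv K).symm
  rw [norm_dualAlgebra, algebraMap_det_baseChange, ← algebraMap_det_baseChange K K',
    det_baseChange_dualMap, h.det_translation, IsScalarTower.algebraMap_apply R K K']

lemma algebraMap_norm_dualAlgebra_of_isUnit {p : ℕ} [Module.Finite R A] [Module.Projective R A]
    {z : A} {r : R} (h : HasCoordinate R (Localization.Away r) p z)
    (R' K' : Type*) [CommRing R'] [Algebra R R'] [CommRing K'] [Algebra R K'] [Algebra R' K']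
    [IsScalarTower R R' K'] (hr : IsUnit (algebraMap R K' r))
    [Module.Free R' (R' ⊗[R] DualAlgebra R A)] (f : DualAlgebra R A) :
    algebraMap R' K' (Algebra.norm R' ((1 : R') ⊗ₜ[R] f)) =
      algebraMap R K' (∏ i : Fin p, f.ofConv (z ^ (i : ℕ))) := by
  let : Algebra (Localization.Away r) K' :=
    (IsLocalization.Away.lift (S := Localization.Away r) r hr).toAlgebra
  have : IsScalarTower R (Localization.Away r) K' :=
    .of_algebraMap_eq' (RingHom.ext fun a ↦
      (IsLocalization.Away.lift_eq (S := Localization.Away r) r hr a).symm)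
  exact algebraMap_norm_dualAlgebra h R' K' f

/-- A criterion for the powers of a character `z` of a finite locally free group scheme to define a
full set of sections of the Cartier dual, in terms of local coordinates. -/
theorem dualNormIsProduct_of_local {p : ℕ} [Module.Finite R A] [Module.Projective R A] (z : A)
    {s : Set R} (hs : Ideal.span s = ⊤)
    (h : ∀ r ∈ s, HasCoordinate R (Localization.Away r) p z) :
    DualNormIsProduct p R A z := by
  intro f R' _ _ _
  refine eq_of_span_eq_top hs fun r hr ↦ ?_
  rw [algebraMap_norm_dualAlgebra_of_isUnit (h r hr) R', ← IsScalarTower.algebraMap_apply]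
  · rfl
  · have hu := IsLocalization.Away.algebraMap_isUnit
      (S := Localization.Away (algebraMap R R' r)) (algebraMap R R' r)
    rwa [← IsScalarTower.algebraMap_apply] at hu

end Local

/-! ### The polynomial `φ` -/

section CongrForm

variable {B B' : Type*} [CommRing B] [CommRing B'] {p : ℕ}

/-- The value at `x` of the polynomial `x ^ p + ∑ (1 / p) (p choose i) ℓ ^ (i - 1) m x ^ i`. -/
def congrForm (p : ℕ) (l m x : B) : B :=
  x ^ p + ∑ i ∈ Finset.Icc 1 (p - 1), ((p.choose i / p : ℕ) : B) * l ^ (i - 1) * m * x ^ i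

lemma map_congrForm (φ : B →+* B') (l m x : B) :
    φ (congrForm p l m x) = congrForm p (φ l) (φ m) (φ x) := by
  simp [congrForm]

/-- For 0 < i < p the binomial coefficient is p times an integer, as p is prime. Replacing that p by
ℓ^(p-1) m turns ℓ^i p into ℓ^p ℓ^(i-1) m. -/
lemma one_add_mul_pow_eq (hp : p.Prime) {l m : B} (h : l ^ (p - 1) * m = p) (x : B) :
    (1 + l * x) ^ p = 1 + l ^ p * congrForm p l m x := by
  obtain ⟨q, rfl⟩ : ∃ q, p = q + 1 := ⟨p - 1, by have := hp.pos; omega⟩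
  rw [add_comm, add_pow, Finset.sum_range_succ, Finset.range_eq_Ico,
    Finset.sum_eq_sum_Ico_succ_bot (by omega), congrForm, mul_add, Finset.mul_sum]
  have : Finset.Icc 1 (q + 1 - 1) = Finset.Ico (0 + 1) (q + 1) := by
    ext; simp
  rw [this]
  have hs : ∑ i ∈ Finset.Ico (0 + 1) (q + 1),
      (l * x) ^ i * 1 ^ (q + 1 - i) * ((q + 1).choose i : B) =
      ∑ i ∈ Finset.Ico (0 + 1) (q + 1), l ^ (q + 1) *
        ((((q + 1).choose i / (q + 1) : ℕ) : B) * l ^ (i - 1) * m * x ^ i) := by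
    refine Finset.sum_congr rfl fun i hi ↦ ?_
    rw [Finset.mem_Ico] at hi
    have hc : ((q + 1).choose i : B) = (((q + 1).choose i / (q + 1) : ℕ) : B) * (l ^ q * m) := by
      rw [show l ^ q * m = ((q + 1 : ℕ) : B) from h, ← Nat.cast_mul,
        Nat.div_mul_cancel (hp.dvd_choose_self (by omega) (by omega))]
    obtain ⟨j, rfl⟩ : ∃ j, i = j + 1 := ⟨i - 1, by omega⟩
    rw [hc, one_pow, Nat.add_sub_cancel]
    ring
  rw [hs]
  simp
  ring

/-- `ℓ` is a nonzerodivisor in the universal ring for the equation `ℓ ^ (p - 1) m = p`. -/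
lemma mul_eq_zero_of_universal (hp : p.Prime)
    (q : MvPolynomial (Fin 4) ℤ ⧸
      Ideal.span {(.X 0 ^ (p - 1) * .X 1 - (p : MvPolynomial (Fin 4) ℤ))})
    (h : Ideal.Quotient.mk _ (.X 0) * q = 0) : q = 0 := by
  obtain ⟨w, rfl⟩ := Ideal.Quotient.mk_surjective q
  rw [← map_mul, Ideal.Quotient.eq_zero_iff_mem, Ideal.mem_span_singleton] at h
  obtain ⟨g, hg⟩ := h
  have hX : Prime (MvPolynomial.X 0 : MvPolynomial (Fin 4) ℤ) := MvPolynomial.X_prime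
  -- At the origin the relation takes the value -p, whereas every multiple of X₀ vanishes there.
  have hd : ¬ MvPolynomial.X 0 ∣ (.X 0 ^ (p - 1) * .X 1 - (p : MvPolynomial (Fin 4) ℤ)) := by
    rintro ⟨c, hc⟩
    have := congrArg (MvPolynomial.eval (0 : Fin 4 → ℤ)) hc
    simp [hp.ne_zero] at this
  -- The prime X₀ divides the product of the relation and g but not the relation, so it divides g
  -- and can be cancelled.
  obtain ⟨c, rfl⟩ := (hX.dvd_or_dvd (Dvd.intro _ hg)).resolve_left hd
  rw [Ideal.Quotient.eq_zero_iff_mem, Ideal.mem_span_singleton]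
  refine ⟨c, mul_left_cancel₀ hX.ne_zero ?_⟩
  rw [hg]; ring

/-- The map x ↦ 1 + ℓx turns ⋆ into multiplication, so `one_add_mul_pow_eq` gives the identity after
multiplication by ℓ^p. This factor cancels in ℤ[ℓ, m, x, y]/(ℓ^(p-1) m - p), and the result
specializes to `B`, where ℓ may be a zero divisor. -/
lemma congrForm_star (hp : p.Prime) {l m : B} (h : l ^ (p - 1) * m = p) (x y : B) :
    congrForm p l m (x + y + l * x * y) = congrForm p l m x + congrForm p l m y +
      l ^ p * congrForm p l m x * congrForm p l m y := by
  set I : Ideal (MvPolynomial (Fin 4) ℤ) :=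
    Ideal.span {(.X 0 ^ (p - 1) * .X 1 - (p : MvPolynomial (Fin 4) ℤ))} with hI
  let v : Fin 4 → MvPolynomial (Fin 4) ℤ ⧸ I := fun i ↦ Ideal.Quotient.mk I (.X i)
  have hv : v 0 ^ (p - 1) * v 1 = p := by
    have : Ideal.Quotient.mk I (.X 0 ^ (p - 1) * .X 1 - (p : MvPolynomial (Fin 4) ℤ)) = 0 :=
      Ideal.Quotient.eq_zero_iff_mem.2 (Ideal.subset_span (Set.mem_singleton _))
    rwa [map_sub, map_mul, map_pow, map_natCast, sub_eq_zero] at this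
  have hreg (k : ℕ) (q : MvPolynomial (Fin 4) ℤ ⧸ I) (hq : v 0 ^ k * q = 0) : q = 0 := by
    induction k with
    | zero => simpa using hq
    | succ k ih => exact ih (mul_eq_zero_of_universal hp _ (by rw [← hq, pow_succ']; ring))
  have key : congrForm p (v 0) (v 1) (v 2 + v 3 + v 0 * v 2 * v 3) -
      (congrForm p (v 0) (v 1) (v 2) + congrForm p (v 0) (v 1) (v 3) +
        v 0 ^ p * congrForm p (v 0) (v 1) (v 2) * congrForm p (v 0) (v 1) (v 3)) = 0 := by
    refine hreg p _ ?_
    have h₁ := one_add_mul_pow_eq hp hv (v 2 + v 3 + v 0 * v 2 * v 3)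
    rw [show 1 + v 0 * (v 2 + v 3 + v 0 * v 2 * v 3) = (1 + v 0 * v 2) * (1 + v 0 * v 3) by ring,
      mul_pow, one_add_mul_pow_eq hp hv, one_add_mul_pow_eq hp hv] at h₁
    linear_combination -h₁
  let ev : MvPolynomial (Fin 4) ℤ →+* B :=
    (MvPolynomial.aeval ![l, m, x, y] : MvPolynomial (Fin 4) ℤ →ₐ[ℤ] B).toRingHom
  let ψ : MvPolynomial (Fin 4) ℤ ⧸ I →+* B := Ideal.Quotient.lift I ev fun a ha ↦ by
    have : I ≤ RingHom.ker ev := by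
      rw [hI, Ideal.span_le, Set.singleton_subset_iff]
      simp [ev, h, RingHom.mem_ker]
    exact this ha
  have hψ (i : Fin 4) : ψ (v i) = ![l, m, x, y] i := by
    simp [ψ, v, ev]
  have := congrArg ψ key
  simp only [map_sub, map_add, map_mul, map_pow, map_congrForm, hψ, map_zero] at this
  simpa [sub_eq_zero] using this

open Polynomial in
/-- The monic polynomial of degree `p` with values `congrForm p l m x`. -/
def congrPoly (p : ℕ) (l m : B) : B[X] := congrForm p (C l) (C m) X

open Polynomial in
lemma eval₂_congrPoly (φ : B →+* B') (l m : B) (x : B') :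
    (congrPoly p l m).eval₂ φ x = congrForm p (φ l) (φ m) x := by
  rw [← coe_eval₂RingHom, congrPoly, map_congrForm]
  simp

open Polynomial in
lemma degree_congrPoly_tail_lt (hp : 0 < p) (l m : B) :
    (∑ i ∈ Finset.Icc 1 (p - 1), ((p.choose i / p : ℕ) : B[X]) * C l ^ (i - 1) * C m * X ^ i).degree
      < (p : WithBot ℕ) := by
  refine (degree_sum_le _ _).trans_lt ((Finset.sup_lt_iff (WithBot.bot_lt_coe p)).2 fun i hi ↦ ?_)
  rw [Finset.mem_Icc] at hi
  rw [← C_eq_natCast, ← C_pow, ← C_mul, ← C_mul]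
  exact (degree_C_mul_X_pow_le _ _).trans_lt (Nat.cast_lt.2 (by omega))

lemma monic_congrPoly (hp : 0 < p) (l m : B) : (congrPoly p l m).Monic :=
  Polynomial.monic_X_pow_add (degree_congrPoly_tail_lt hp l m)

lemma natDegree_congrPoly [Nontrivial B] (hp : 0 < p) (l m : B) :
    (congrPoly p l m).natDegree = p := by
  rw [congrPoly, congrForm, Polynomial.natDegree_add_eq_left_of_degree_lt, 
    Polynomial.natDegree_X_pow]
  rw [Polynomial.degree_X_pow]
  exact degree_congrPoly_tail_lt hp l m

end CongrForm

/-! ### Sections and their pullbacks -/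

section Sections

variable {X Y Z : Scheme.{u}}

/-- Restriction of functions. -/
def res {W W' : X.Opens} (h : W' ≤ W) : Γ(X, W) →+* Γ(X, W') := (X.presheaf.map (homOfLE h).op).hom

/-- Pullback of functions. -/
def pb (f : X ⟶ Y) (U : Y.Opens) (W : X.Opens) (h : W ≤ f ⁻¹ᵁ U) : Γ(Y, U) →+* Γ(X, W) :=
  (f.appLE U W h).hom

lemma map_eq_res {W W' : X.Opens} (i : W' ⟶ W) (x : Γ(X, W)) :
    X.presheaf.map i.op x = res i.le x := rfl

lemma app_eq_pb (f : X ⟶ Y) (U : Y.Opens) (x : Γ(Y, U)) : f.app U x = pb f U _ le_rfl x := by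
  simp [pb, Scheme.Hom.appLE]

@[simp]
lemma res_res {W W' W'' : X.Opens} (h : W' ≤ W) (h' : W'' ≤ W') (x : Γ(X, W)) :
    res h' (res h x) = res (h'.trans h) x := by
  simp only [res, ← CommRingCat.comp_apply, ← Functor.map_comp]
  rfl

@[simp]
lemma res_self {W : X.Opens} (x : Γ(X, W)) : res le_rfl x = x := by
  change (X.presheaf.map (𝟙 _)).hom x = x
  simp

@[simp]
lemma res_pb (f : X ⟶ Y) {U : Y.Opens} {W W' : X.Opens} (h : W ≤ f ⁻¹ᵁ U) (h' : W' ≤ W)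
    (x : Γ(Y, U)) : res h' (pb f U W h x) = pb f U W' (h'.trans h) x := by
  simp only [res, pb, ← CommRingCat.comp_apply, Scheme.Hom.appLE_map]

@[simp]
lemma pb_res (f : X ⟶ Y) {U U' : Y.Opens} {W : X.Opens} (h : W ≤ f ⁻¹ᵁ U) (h' : U ≤ U')
    (x : Γ(Y, U')) :
    pb f U W h (res h' x) = pb f U' W (h.trans (f.preimage_mono h')) x := by
  simp only [res, pb, ← CommRingCat.comp_apply, Scheme.Hom.map_appLE]

lemma pb_pb (f : X ⟶ Y) (g : Y ⟶ Z) {U : Z.Opens} {V : Y.Opens} {W : X.Opens} (h : V ≤ g ⁻¹ᵁ U)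
    (h' : W ≤ f ⁻¹ᵁ V) (k : X ⟶ Z) (hk : f ≫ g = k) (x : Γ(Z, U)) :
    pb f V W h' (pb g U V h x) = pb k U W (by
      subst hk; exact h'.trans (f.preimage_mono h)) x := by
  subst hk
  simp only [pb, ← CommRingCat.comp_apply, Scheme.Hom.appLE_comp_appLE]

lemma res_injective {W W' : X.Opens} (h : W' ≤ W) (h' : W ≤ W') :
    Function.Injective (res h) :=
  Function.LeftInverse.injective (g := res h') fun x ↦ by simp

lemma pb_of_eq_id {f : X ⟶ X} (hf : f = 𝟙 X) {W : X.Opens} (h : W ≤ f ⁻¹ᵁ W) (x : Γ(X, W)) :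
    pb f W W h x = x := by
  subst hf
  have : (𝟙 X : X ⟶ X).appLE W W h = 𝟙 _ := by
    have e : (homOfLE h).op = 𝟙 (op W) := rfl
    simp only [Scheme.Hom.appLE, e]
    exact (Category.id_comp _).trans (X.presheaf.map_id _)
  simp [pb, this]

lemma bijective_pb_of_isOpenImmersion (f : X ⟶ Y) [IsOpenImmersion f] {V : Y.Opens}
    (hV : V ≤ f.opensRange) {W : X.Opens} (h : W ≤ f ⁻¹ᵁ V) (h' : f ⁻¹ᵁ V ≤ W) :
    Function.Bijective (pb f V W h) := by
  obtain rfl : W = f ⁻¹ᵁ V := le_antisymm h h'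
  have := f.isIso_app V hV
  have e : pb f V _ h = (f.app V).hom := RingHom.ext fun x ↦ (app_eq_pb f V x).symm
  rw [e]
  exact ConcreteCategory.bijective_of_isIso (f.app V)

lemma preimage_inf_opensRange (f : X ⟶ Y) [IsOpenImmersion f] (W : Y.Opens) :
    f ⁻¹ᵁ W ≤ f ⁻¹ᵁ (f.opensRange ⊓ W) := fun x hx ↦ ⟨⟨x, rfl⟩, hx⟩

lemma le_iSup_opensRange_inf (𝒰 : X.OpenCover) (W : X.Opens) :
    W ≤ ⨆ i, (𝒰.f i).opensRange ⊓ W := by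
  rw [← iSup_inf_eq, 𝒰.iSup_opensRange, top_inf_eq]

/-- Functions which agree locally agree. -/
lemma eq_of_pb_eq (𝒰 : X.OpenCover) {W : X.Opens} {x y : Γ(X, W)}
    (h : ∀ i, pb (𝒰.f i) W _ le_rfl x = pb (𝒰.f i) W _ le_rfl y) : x = y := by
  refine TopCat.Sheaf.eq_of_locally_eq' X.sheaf (fun i ↦ (𝒰.f i).opensRange ⊓ W) W
    (fun i ↦ homOfLE inf_le_right) (le_iSup_opensRange_inf 𝒰 W) x y fun i ↦ ?_
  have hi := preimage_inf_opensRange (𝒰.f i) W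
  apply (bijective_pb_of_isOpenImmersion (𝒰.f i) inf_le_left hi
    ((𝒰.f i).preimage_mono inf_le_right)).1
  change pb _ _ _ hi (res inf_le_right x) = pb _ _ _ hi (res inf_le_right y)
  rw [pb_res, pb_res, h]

/-- Functions given locally in a compatible way glue. -/
lemma exists_pb_eq (𝒰 : X.OpenCover) (W : X.Opens) (x : ∀ i, Γ(𝒰.X i, 𝒰.f i ⁻¹ᵁ W))
    (h : ∀ i j, ∀ (V : (pullback (𝒰.f i) (𝒰.f j)).Opens)
      (h₁ : V ≤ pullback.fst (𝒰.f i) (𝒰.f j) ⁻¹ᵁ (𝒰.f i ⁻¹ᵁ W))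
      (h₂ : V ≤ pullback.snd (𝒰.f i) (𝒰.f j) ⁻¹ᵁ (𝒰.f j ⁻¹ᵁ W)),
      pb (pullback.fst (𝒰.f i) (𝒰.f j)) _ V h₁ (x i) =
        pb (pullback.snd (𝒰.f i) (𝒰.f j)) _ V h₂ (x j)) :
    ∃ y : Γ(X, W), ∀ i, pb (𝒰.f i) W _ le_rfl y = x i := by
  choose y hy using fun i ↦ (bijective_pb_of_isOpenImmersion (𝒰.f i) inf_le_left
    (preimage_inf_opensRange (𝒰.f i) W) ((𝒰.f i).preimage_mono inf_le_right)).2 (x i)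
  have hz : ∃ z : Γ(X, W), ∀ i, res inf_le_right z = y i := by
    refine (TopCat.Sheaf.existsUnique_gluing' X.sheaf (fun i ↦ (𝒰.f i).opensRange ⊓ W) W
      (fun i ↦ homOfLE inf_le_right) (le_iSup_opensRange_inf 𝒰 W) y fun i j ↦ ?_).exists
    let V := ((𝒰.f i).opensRange ⊓ W) ⊓ ((𝒰.f j).opensRange ⊓ W)
    change res (inf_le_left : V ≤ _) (y i) = res (inf_le_right : V ≤ _) (y j)
    -- The overlap of two members of the cover is the image of their fibre product, so compatibility
    -- may be tested after pullback to it.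
    have hV : V ≤ (pullback.fst (𝒰.f i) (𝒰.f j) ≫ 𝒰.f i).opensRange := by
      intro a ha
      have := IsOpenImmersion.range_pullback_to_base_of_left (𝒰.f i) (𝒰.f j)
      exact this.ge ⟨ha.1.1, ha.2.1⟩
    apply (bijective_pb_of_isOpenImmersion (pullback.fst (𝒰.f i) (𝒰.f j) ≫ 𝒰.f i) hV
      le_rfl le_rfl).1
    rw [pb_res, pb_res, ← pb_pb (pullback.fst (𝒰.f i) (𝒰.f j)) (𝒰.f i)
      (preimage_inf_opensRange (𝒰.f i) W) _ _ rfl, hy, ← pb_pb (pullback.snd (𝒰.f i) (𝒰.f j))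
        (𝒰.f j) (preimage_inf_opensRange (𝒰.f j) W) _ _ pullback.condition.symm, hy]
    · exact h i j _ _ _
    · intro a ha
      have := ha.2.2
      simpa [pullback.condition] using this
    · exact fun a ha ↦ ha.1.2
  obtain ⟨z, hz⟩ := hz
  refine ⟨z, fun i ↦ ?_⟩
  rw [← hy, ← hz, pb_res]

lemma le_preimage_top (f : X ⟶ Y) {W : X.Opens} : W ≤ f ⁻¹ᵁ ⊤ := le_top

lemma preimage_le_inf (f : X ⟶ Y) {U : Y.Opens} (h : ⊤ ≤ f ⁻¹ᵁ U) (V : Y.Opens) :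
    f ⁻¹ᵁ V ≤ f ⁻¹ᵁ (V ⊓ U) := le_inf le_rfl (le_top.trans h)

end Sections

/-! ### Points of the line bundle in local coordinates. -/

section LinePoints

variable {S : Scheme.{u}} {L : S.Modules}

/-- Restriction of sections of a module. -/
def resM (L : S.Modules) {W W' : S.Opens} (h : W' ≤ W) : Γ(L, W) →+ Γ(L, W') :=
  (L.presheaf.map (homOfLE h).op).hom

lemma map_eq_resM {W W' : S.Opens} (i : W' ⟶ W) (x : Γ(L, W)) :
    L.presheaf.map i.op x = resM L i.le x := rfl

@[simp]
lemma resM_resM {W W' W'' : S.Opens} (h : W' ≤ W) (h' : W'' ≤ W') (x : Γ(L, W)) :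
    resM L h' (resM L h x) = resM L (h'.trans h) x := by
  simp only [resM, ← AddCommGrpCat.comp_apply, ← Functor.map_comp]
  rfl

@[simp]
lemma resM_self {W : S.Opens} (x : Γ(L, W)) : resM L le_rfl x = x := by
  change (L.presheaf.map (𝟙 _)).hom x = x
  simp

@[simp]
lemma resM_smul {W W' : S.Opens} (h : W' ≤ W) (r : Γ(S, W)) (x : Γ(L, W)) :
    resM L h (r • x) = res h r • resM L h x :=
  Scheme.Modules.map_smul L (homOfLE h) r x

/-- `e` is a trivialization of `L` over `U`. -/
def IsTrivialization {U : S.Opens} (e : Γ(L, U)) : Prop :=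
  ∀ (V : S.Opens) (i : V ⟶ U),
    Function.Bijective fun a : Γ(S, V) ↦ a • (L.presheaf.map i.op e : Γ(L, V))

namespace IsTrivialization

variable {U : S.Opens} {e : Γ(L, U)} (he : IsTrivialization e)

/-- The coordinate of a section with respect to a trivialization. -/
def coeff {V : S.Opens} (hV : V ≤ U) (ξ : Γ(L, V)) : Γ(S, V) :=
  (Equiv.ofBijective _ (he V (homOfLE hV))).symm ξ

lemma coeff_smul_res {V : S.Opens} (hV : V ≤ U) (ξ : Γ(L, V)) :
    he.coeff hV ξ • resM L hV e = ξ :=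
  (Equiv.ofBijective _ (he V (homOfLE hV))).apply_symm_apply ξ

lemma coeff_eq {V : S.Opens} (hV : V ≤ U) {ξ : Γ(L, V)} {a : Γ(S, V)}
    (h : a • resM L hV e = ξ) : he.coeff hV ξ = a :=
  (Equiv.ofBijective _ (he V (homOfLE hV))).symm_apply_eq.2 h.symm

lemma coeff_add {V : S.Opens} (hV : V ≤ U) (ξ η : Γ(L, V)) :
    he.coeff hV (ξ + η) = he.coeff hV ξ + he.coeff hV η :=
  he.coeff_eq _ (by rw [add_smul, coeff_smul_res, coeff_smul_res])

lemma coeff_smul {V : S.Opens} (hV : V ≤ U) (r : Γ(S, V)) (ξ : Γ(L, V)) :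
    he.coeff hV (r • ξ) = r * he.coeff hV ξ :=
  he.coeff_eq _ (by rw [mul_smul, coeff_smul_res])

lemma coeff_res {V V' : S.Opens} (hV : V ≤ U) (h : V' ≤ V) (ξ : Γ(L, V)) :
    he.coeff (h.trans hV) (resM L h ξ) = res h (he.coeff hV ξ) :=
  he.coeff_eq _ (by
    conv_rhs => rw [← he.coeff_smul_res hV ξ]
    rw [resM_smul, resM_resM])

end IsTrivialization

variable {T T' : Over S}

namespace LinePoint

lemma app_res (u : LinePoint L T) {V U : S.Opens} (h : V ≤ U) (ξ : Γ(L, U)) :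
    u.app V (resM L h ξ) = res (T.hom.preimage_mono h) (u.app U ξ) :=
  u.app_map (homOfLE h) ξ

lemma app_smul' (u : LinePoint L T) (U : S.Opens) (r : Γ(S, U)) (ξ : Γ(L, U)) :
    u.app U (r • ξ) = pb T.hom U _ le_rfl r * u.app U ξ := by
  rw [u.app_smul, app_eq_pb]

lemma pullback_app (u : LinePoint L T) (a : T' ⟶ T) (U : S.Opens) (ξ : Γ(L, U)) :
    (u.pullback a).app U ξ = pb a.left _ _ (preimage_le a U) (u.app U ξ) := rfl

lemma pullback_id (u : LinePoint L T) : u.pullback (𝟙 T) = u := by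
  ext U ξ
  exact pb_of_eq_id rfl _ _

lemma pullback_comp {T'' : Over S} (u : LinePoint L T) (a : T' ⟶ T) (b : T'' ⟶ T') :
    u.pullback (b ≫ a) = (u.pullback a).pullback b := by
  ext U ξ
  simp only [pullback_app]
  rw [pb_pb _ _ _ _ (b ≫ a).left rfl]

variable {U : S.Opens}

/-- The value of a point of the line bundle at a section `e`, over a scheme whose image is
contained in the domain of definition of `e`. -/
def val (u : LinePoint L T) (e : Γ(L, U)) (hT : ⊤ ≤ T.hom ⁻¹ᵁ U) : Γ(T.left, ⊤) :=
  res hT (u.app U e)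

lemma val_pullback (u : LinePoint L T) (e : Γ(L, U)) (hT : ⊤ ≤ T.hom ⁻¹ᵁ U) (a : T' ⟶ T)
    (hT' : ⊤ ≤ T'.hom ⁻¹ᵁ U) :
    (u.pullback a).val e hT' = pb a.left ⊤ ⊤ (le_preimage_top _) (u.val e hT) := by
  rw [val, val, pullback_app, res_pb, pb_res]

/-- Since T maps into U, the preimages of V and V ⊓ U coincide, and over V ⊓ U every section is a
multiple of `e`. -/
lemma app_eq_mul_val (u : LinePoint L T) {e : Γ(L, U)} (he : IsTrivialization e)
    (hT : ⊤ ≤ T.hom ⁻¹ᵁ U) (V : S.Opens) (ξ : Γ(L, V)) :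
    u.app V ξ = pb T.hom (V ⊓ U) (T.hom ⁻¹ᵁ V) (preimage_le_inf T.hom hT V)
      (he.coeff inf_le_right (resM L inf_le_left ξ)) * res le_top (u.val e hT) := by
  have h : T.hom ⁻¹ᵁ V ≤ T.hom ⁻¹ᵁ (V ⊓ U) := preimage_le_inf T.hom hT V
  apply res_injective (T.hom.preimage_mono (inf_le_left : V ⊓ U ≤ V)) h
  rw [← u.app_res (inf_le_left : V ⊓ U ≤ V)]
  conv_lhs => rw [← he.coeff_smul_res inf_le_right (resM L inf_le_left ξ)]
  rw [app_smul', u.app_res]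
  simp only [val, map_mul, res_pb, res_res]

/-- Over a trivialization, a point of the line bundle is determined by its value at the
trivializing section. -/
lemma ext_val {u v : LinePoint L T} {e : Γ(L, U)} (he : IsTrivialization e)
    (hT : ⊤ ≤ T.hom ⁻¹ᵁ U) (h : u.val e hT = v.val e hT) : u = v := by
  ext V ξ
  rw [u.app_eq_mul_val he hT, v.app_eq_mul_val he hT, h]

/-- The point of the line bundle with a given value at the trivializing section. -/
def ofVal {e : Γ(L, U)} (he : IsTrivialization e) (hT : ⊤ ≤ T.hom ⁻¹ᵁ U) (b : Γ(T.left, ⊤)) :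
    LinePoint L T where
  app V := AddMonoidHom.mk' (fun ξ ↦
    pb T.hom (V ⊓ U) (T.hom ⁻¹ᵁ V) (preimage_le_inf T.hom hT V)
      (he.coeff inf_le_right (resM L inf_le_left ξ)) * res le_top b) fun ξ η ↦ by
    rw [map_add, he.coeff_add, map_add, add_mul]
  app_smul V r ξ := by
    simp [he.coeff_smul, app_eq_pb, mul_assoc]
  app_map {V V'} i ξ := by
    simp only [AddMonoidHom.mk'_apply, map_eq_resM, resM_resM, map_mul]
    have h : V ⊓ U ≤ V' ⊓ U := inf_le_inf_right _ i.le
    rw [← resM_resM (inf_le_left : V' ⊓ U ≤ V') h, he.coeff_res inf_le_right h, pb_res]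
    erw [res_pb, res_res]

@[simp]
lemma val_ofVal {e : Γ(L, U)} (he : IsTrivialization e) (hT : ⊤ ≤ T.hom ⁻¹ᵁ U)
    (b : Γ(T.left, ⊤)) : (ofVal he hT b).val e hT = b := by
  have : (he.coeff (V := U ⊓ U) inf_le_right (resM L inf_le_left e)) = 1 :=
    he.coeff_eq _ (one_smul _ _)
  simp [val, ofVal, this]

end LinePoint

end LinePoints

/-! ### The kernel of φ as a group functor. -/

namespace Triple

variable {p : ℕ} {S : Scheme.{u}} (X : Triple p S) {T T' : Over S}

section Trivialization

variable {U : S.Opens} {e : Γ(X.L, U)} (he : IsTrivialization e)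

/-- The coordinate of `λ` with respect to a trivialization. -/
def lamCoeff : Γ(S, U) := he.coeff le_rfl (resM X.L le_top X.lam)

/-- The coordinate of `μ` with respect to a trivialization. -/
def muCoeff (e : Γ(X.L, U)) : Γ(S, U) := X.mu.app U fun _ ↦ e

lemma mu_app_res {V W : S.Opens} (h : V ≤ W) (ξ : Fin (p - 1) → Γ(X.L, W)) :
    X.mu.app V (fun j ↦ resM X.L h (ξ j)) = res h (X.mu.app W ξ) :=
  X.mu.map_app (homOfLE h) ξ

lemma mu_app_eq {V : S.Opens} (hV : V ≤ U) (ξ : Fin (p - 1) → Γ(X.L, V)) :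
    X.mu.app V ξ = (∏ j, he.coeff hV (ξ j)) * res hV (X.muCoeff e) := by
  conv_lhs => rw [show ξ = fun j ↦ he.coeff hV (ξ j) • resM X.L hV e from
    funext fun j ↦ (he.coeff_smul_res hV (ξ j)).symm]
  rw [MultilinearMap.map_smul_univ, smul_eq_mul, muCoeff, mu_app_res]

lemma lamCoeff_pow_mul_muCoeff :
    X.lamCoeff he ^ (p - 1) * X.muCoeff e = p := by
  have h := X.mu_app_res (le_top : U ≤ ⊤) fun _ ↦ X.lam
  rw [X.mu_lam, X.mu_app_eq he le_rfl, map_natCast] at h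
  simpa [lamCoeff] using h

lemma lamMul_eq (u : LinePoint X.L T) (U : S.Opens) :
    X.lamMul u U = u.app U (resM X.L le_top X.lam) := rfl

variable (hT : ⊤ ≤ T.hom ⁻¹ᵁ U)

lemma lamMul_eq_mul_val (u : LinePoint X.L T) (V : S.Opens) :
    X.lamMul u V =
      res le_top (pb T.hom U ⊤ hT (X.lamCoeff he)) * res le_top (u.val e hT) := by
  rw [lamMul_eq, u.app_eq_mul_val he hT, resM_resM, lamCoeff,
    ← resM_resM (le_top : U ≤ ⊤) inf_le_right, he.coeff_res le_rfl inf_le_right, pb_res, res_pb]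

/-- In the i-th term the powers of λ ⊗ u contribute ℓ^(i-1) x^(i-1), μ takes the p - 1 arguments ξ,
and u(ζ) supplies the last factor x. The coordinates of the arguments thus separate from the scalar
polynomial. -/
lemma phi_eq (hp : p.Prime) (u : LinePoint X.L T) (V : S.Opens)
    (ξ : Fin (p - 1) → Γ(X.L, V)) (ζ : Γ(X.L, V)) :
    X.phi u V ξ ζ =
      (∏ j, pb T.hom (V ⊓ U) (T.hom ⁻¹ᵁ V) (preimage_le_inf T.hom hT V)
        (he.coeff inf_le_right (resM X.L inf_le_left (ξ j)))) *
      pb T.hom (V ⊓ U) (T.hom ⁻¹ᵁ V) (preimage_le_inf T.hom hT V)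
        (he.coeff inf_le_right (resM X.L inf_le_left ζ)) *
      res le_top (congrForm p (pb T.hom U ⊤ hT (X.lamCoeff he)) (pb T.hom U ⊤ hT (X.muCoeff e))
        (u.val e hT)) := by
  have hmu : T.hom.app V (X.mu.app V ξ) =
      (∏ j, pb T.hom (V ⊓ U) (T.hom ⁻¹ᵁ V) (preimage_le_inf T.hom hT V)
        (he.coeff inf_le_right (resM X.L inf_le_left (ξ j)))) *
      res le_top (pb T.hom U ⊤ hT (X.muCoeff e)) := by
    rw [app_eq_pb, res_pb, ← pb_res T.hom (preimage_le_inf T.hom hT V) inf_le_left,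
      ← mu_app_res, X.mu_app_eq he inf_le_right, map_mul, map_prod, pb_res]
  rw [phi, u.app_eq_mul_val he hT V ζ, hmu, X.lamMul_eq_mul_val he hT u V, map_congrForm, congrForm]
  simp only [u.app_eq_mul_val he hT V (ξ _), Finset.prod_mul_distrib, Finset.prod_const,
    Finset.card_univ, Fintype.card_fin]
  rw [mul_add, Finset.mul_sum]
  congr 1
  · rw [← pow_sub_one_mul hp.ne_zero (res _ (u.val e hT))]
    ring
  · refine Finset.sum_congr rfl fun i hi ↦ ?_
    obtain ⟨k, rfl⟩ : ∃ k, i = k + 1 := ⟨i - 1, by have := (Finset.mem_Icc.1 hi).1; omega⟩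
    simp only [Nat.add_sub_cancel]
    ring

/-- Taking every ξ_j and ζ equal to `e`, with coordinate 1, isolates the scalar polynomial; all
other values are multiples of it. -/
lemma phi_eq_zero_iff (hp : p.Prime) (u : LinePoint X.L T) :
    (∀ V ξ ζ, X.phi u V ξ ζ = 0) ↔
      congrForm p (pb T.hom U ⊤ hT (X.lamCoeff he)) (pb T.hom U ⊤ hT (X.muCoeff e))
        (u.val e hT) = 0 := by
  constructor
  · intro h
    have h₁ := h U (fun _ ↦ e) e
    have h₂ : (he.coeff (V := U ⊓ U) inf_le_right (resM X.L inf_le_left e)) = 1 :=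
      he.coeff_eq _ (one_smul _ _)
    simp only [X.phi_eq he hT hp, h₂, map_one, Finset.prod_const_one, one_mul] at h₁
    have := congrArg (res hT) h₁
    rwa [res_res, res_self, map_zero] at this
  · intro h V ξ ζ
    rw [X.phi_eq he hT hp, h, map_zero, mul_zero]

lemma val_star (u v : LinePoint X.L T) :
    (X.star u v).val e hT = u.val e hT + v.val e hT +
      pb T.hom U ⊤ hT (X.lamCoeff he) * u.val e hT * v.val e hT := by
  have : (X.star u v).app U e = u.app U e + v.app U e + X.lamMul u U * v.app U e := rfl
  rw [LinePoint.val, this, X.lamMul_eq_mul_val he hT]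
  simp [LinePoint.val]

lemma oneAdd_eq_one_add_lamMul (u : LinePoint X.L T) :
    X.oneAdd u = 1 + res (le_preimage_top T.hom) (X.lamMul u ⊤) := by
  have h : X.lamMul u ⊤ = u.app ⊤ X.lam := by rw [lamMul_eq, resM_self]
  rw [h]
  exact congrArg (1 + ·) (res_self (X := T.left) (W := ⊤) (u.app ⊤ X.lam)).symm

lemma oneAdd_eq (u : LinePoint X.L T) :
    X.oneAdd u = 1 + pb T.hom U ⊤ hT (X.lamCoeff he) * u.val e hT := by
  rw [oneAdd_eq_one_add_lamMul, X.lamMul_eq_mul_val he hT, map_mul, res_res, res_res, res_self,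
    res_self]

end Trivialization

lemma lamMul_pullback (u : LinePoint X.L T) (a : T' ⟶ T) (U : S.Opens) :
    X.lamMul (u.pullback a) U = pb a.left _ _ (preimage_le a U) (X.lamMul u U) := rfl

lemma oneAdd_pullback (u : LinePoint X.L T) (a : T' ⟶ T) :
    X.oneAdd (u.pullback a) = pb a.left ⊤ ⊤ (le_preimage_top _) (X.oneAdd u) := by
  rw [oneAdd, oneAdd, map_add, map_one]
  rfl

lemma phi_pullback (u : LinePoint X.L T) (a : T' ⟶ T) (U : S.Opens)
    (ξ : Fin (p - 1) → Γ(X.L, U)) (ζ : Γ(X.L, U)) :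
    X.phi (u.pullback a) U ξ ζ = pb a.left _ _ (preimage_le a U) (X.phi u U ξ ζ) := by
  have h (x : Γ(S, U)) : T'.hom.app U x =
      pb a.left _ _ (preimage_le a U) (T.hom.app U x) := by
    rw [app_eq_pb, app_eq_pb, pb_pb _ _ _ _ T'.hom (Over.w a)]
  simp only [phi, LinePoint.pullback_app, lamMul_pullback, h, map_add, map_mul, map_sum,
    map_prod, map_pow, map_natCast]

lemma star_pullback (u v : LinePoint X.L T) (a : T' ⟶ T) :
    (X.star u v).pullback a = X.star (u.pullback a) (v.pullback a) := by
  ext U ξ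
  change pb a.left _ _ (preimage_le a U) (u.app U ξ + v.app U ξ + X.lamMul u U * v.app U ξ) = _
  rw [map_add, map_add, map_mul]
  rfl

/-- At ξ_j = ζ = λ, since μ(λ, ..., λ) = p, the value of φ(u) is the polynomial with parameters ℓ =
1 and m = p evaluated at λ ⊗ u, which is (1 + λ ⊗ u)^p - 1. No trivialization is involved. -/
lemma one_add_lamMul_pow (hp : p.Prime) {u : LinePoint X.L T} (h : ∀ U ξ ζ, X.phi u U ξ ζ = 0)
    (U : S.Opens) : (1 + X.lamMul u U) ^ p = 1 := by
  have h₁ := h U (fun _ ↦ resM X.L le_top X.lam) (resM X.L le_top X.lam)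
  have h₂ := one_add_mul_pow_eq hp (l := (1 : Γ(T.left, T.hom ⁻¹ᵁ U))) (m := p) (by simp)
    (X.lamMul u U)
  rw [one_mul, one_pow, one_mul] at h₂
  rw [h₂, add_eq_left, ← h₁, phi, congrForm, X.mu_app_res, X.mu_lam, ← lamMul_eq]
  simp only [map_natCast, Finset.prod_const, Finset.card_univ, Fintype.card_fin, one_pow, mul_one]
  congr 1
  · rw [← pow_succ, Nat.sub_add_cancel hp.one_le]
  · refine Finset.sum_congr rfl fun i hi ↦ ?_
    obtain ⟨k, rfl⟩ : ∃ k, i = k + 1 := ⟨i - 1, by have := (Finset.mem_Icc.1 hi).1; omega⟩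
    simp only [Nat.add_sub_cancel]
    ring

lemma oneAdd_pow (hp : p.Prime) {u : LinePoint X.L T} (h : ∀ U ξ ζ, X.phi u U ξ ζ = 0) :
    X.oneAdd u ^ p = 1 := by
  rw [oneAdd_eq_one_add_lamMul, ← map_one (res (le_preimage_top T.hom)), ← map_add, ← map_pow,
    X.one_add_lamMul_pow hp h ⊤]

/-- The equation (1 + λ ⊗ u)^p = 1 already makes 1 + λ ⊗ u a unit. -/
lemma isKernelPoint_iff (hp : p.Prime) {u : LinePoint X.L T} :
    X.IsKernelPoint u ↔ ∀ U ξ ζ, X.phi u U ξ ζ = 0 :=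
  ⟨fun h ↦ h.2, fun h ↦ ⟨.of_pow_eq_one (X.oneAdd_pow hp h) hp.ne_zero, h⟩⟩

lemma IsKernelPoint.pullback (hp : p.Prime) {u : LinePoint X.L T} (h : X.IsKernelPoint u)
    (a : T' ⟶ T) : X.IsKernelPoint (u.pullback a) :=
  (X.isKernelPoint_iff hp).2 fun U ξ ζ ↦ by rw [phi_pullback, h.2, map_zero]

lemma isKernelPoint_of_cover (hp : p.Prime) {u : LinePoint X.L T} (𝒰 : Scheme.OpenCover.{v} T.left)
    (h : ∀ i, X.IsKernelPoint (u.pullback (Over.homMk (𝒰.f i) : Over.mk (𝒰.f i ≫ T.hom) ⟶ T))) :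
    X.IsKernelPoint u := by
  refine (X.isKernelPoint_iff hp).2 fun U ξ ζ ↦ eq_of_pb_eq 𝒰 fun i ↦ ?_
  have := (h i).2 U ξ ζ
  rw [phi_pullback] at this
  rw [map_zero]
  exact this

/-- Any `S`-scheme has an open cover over which `L` is trivialized. -/
lemma exists_cover (T : Over S) :
    ∃ 𝒰 : Scheme.OpenCover.{u} T.left, ∀ i, ∃ (U : S.Opens) (e : Γ(X.L, U)),
    IsTrivialization e ∧ ⊤ ≤ (𝒰.f i ≫ T.hom) ⁻¹ᵁ U := by
  choose U hU e he using X.isInvertible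
  let V : T.left → T.left.Opens := fun t ↦ T.hom ⁻¹ᵁ U (T.hom t)
  refine ⟨T.left.openCoverOfIsOpenCover V
    (.mk (top_unique fun t _ ↦ TopologicalSpace.Opens.mem_iSup.2 ⟨t, hU _⟩)), fun (i : T.left) ↦
    ⟨U (T.hom i), e (T.hom i), he _, ?_⟩⟩
  rintro ⟨t, ht⟩ -
  exact ht

/-- Vanishing of φ is local on T, and over a trivialization `congrForm_star` expresses the value at
u ⋆ v through the values at u and v. -/
lemma IsKernelPoint.star (hp : p.Prime) {u v : LinePoint X.L T} (hu : X.IsKernelPoint u)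
    (hv : X.IsKernelPoint v) : X.IsKernelPoint (X.star u v) := by
  obtain ⟨𝒰, h⟩ := X.exists_cover T
  refine X.isKernelPoint_of_cover hp 𝒰 fun i ↦ ?_
  obtain ⟨U, e, he, hT⟩ := h i
  rw [X.star_pullback, X.isKernelPoint_iff hp,
    X.phi_eq_zero_iff (T := Over.mk (𝒰.f i ≫ T.hom)) he hT hp, X.val_star he, congrForm_star hp,
    (X.phi_eq_zero_iff he hT hp _).1 (hu.pullback X hp _).2,
    (X.phi_eq_zero_iff he hT hp _).1 (hv.pullback X hp _).2]
  · simp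
  · rw [← map_pow, ← map_mul, lamCoeff_pow_mul_muCoeff, map_natCast]

/-- The inverse `-(1 + λ ⊗ u)⁻¹ u` of a point of `𝒢^{(λ)}` with `(1 + λ ⊗ u) ^ p = 1`. -/
def inv (u : LinePoint X.L T) : LinePoint X.L T where
  app U := (AddMonoidHom.mulLeft (-(1 + X.lamMul u U) ^ (p - 1))).comp (u.app U)
  app_smul U r ξ := by
    simp only [AddMonoidHom.comp_apply, AddMonoidHom.coe_mulLeft, u.app_smul]
    ring
  app_map i ξ := by
    simp only [AddMonoidHom.comp_apply, AddMonoidHom.coe_mulLeft, u.app_map, X.lamMul_map u i,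
      map_neg, map_add, map_mul, map_pow, map_one]

instance : Zero (LinePoint X.L T) where
  zero := { app := fun _ ↦ 0, app_smul := by simp, app_map := by simp }

lemma zero_app (U : S.Opens) (ξ : Γ(X.L, U)) : (0 : LinePoint X.L T).app U ξ = 0 := rfl

lemma zero_pullback (a : T' ⟶ T) : (0 : LinePoint X.L T).pullback a = 0 := by
  ext U ξ
  exact map_zero (pb a.left _ _ (preimage_le a U))

lemma inv_app (u : LinePoint X.L T) (U : S.Opens) (ξ : Γ(X.L, U)) :
    (X.inv u).app U ξ = -(1 + X.lamMul u U) ^ (p - 1) * u.app U ξ := rfl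

lemma star_app (u v : LinePoint X.L T) (U : S.Opens) (ξ : Γ(X.L, U)) :
    (X.star u v).app U ξ = u.app U ξ + v.app U ξ + X.lamMul u U * v.app U ξ := rfl

lemma lamMul_star (u v : LinePoint X.L T) (U : S.Opens) : X.lamMul (X.star u v) U =
    X.lamMul u U + X.lamMul v U + X.lamMul u U * X.lamMul v U := rfl

lemma oneAdd_star (u v : LinePoint X.L T) :
    X.oneAdd (X.star u v) = X.oneAdd u * X.oneAdd v := by
  simp only [oneAdd_eq_one_add_lamMul, lamMul_star, map_add, map_mul]
  ring

lemma star_assoc (u v w : LinePoint X.L T) :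
    X.star (X.star u v) w = X.star u (X.star v w) := by
  ext U ξ
  simp only [star_app, lamMul_star]
  ring

lemma zero_star (u : LinePoint X.L T) : X.star 0 u = u := by
  ext U ξ
  simp [star_app, lamMul_eq, zero_app]

lemma inv_star (hp : p.Prime) {u : LinePoint X.L T} (hu : X.IsKernelPoint u) :
    X.star (X.inv u) u = 0 := by
  ext U ξ
  have h := X.one_add_lamMul_pow hp hu.2 U
  have h' : X.lamMul (X.inv u) U = -(1 + X.lamMul u U) ^ (p - 1) * X.lamMul u U := rfl
  rw [star_app, inv_app, h', zero_app]
  rw [← pow_sub_one_mul hp.ne_zero] at h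
  linear_combination -(u.app U ξ) * h

lemma isKernelPoint_zero (hp : p.Prime) : X.IsKernelPoint (0 : LinePoint X.L T) :=
  (X.isKernelPoint_iff hp).2 fun U ξ ζ ↦ by simp [phi, zero_app]

/-- The value at the inverse is not computed directly. With w the inverse of u, locally 0 = φ(w ⋆ u)
= φ(w) + φ(u) + ℓ^p φ(w) φ(u), and φ(u) = 0. -/
lemma IsKernelPoint.inv (hp : p.Prime) {u : LinePoint X.L T} (hu : X.IsKernelPoint u) :
    X.IsKernelPoint (X.inv u) := by
  obtain ⟨𝒰, h⟩ := X.exists_cover T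
  refine X.isKernelPoint_of_cover hp 𝒰 fun i ↦ ?_
  obtain ⟨U, e, he, hT⟩ := h i
  let T' : Over S := Over.mk (𝒰.f i ≫ T.hom)
  let a : T' ⟶ T := Over.homMk (𝒰.f i)
  have hu' := (X.phi_eq_zero_iff he hT hp _).1 (hu.pullback X hp a).2
  have h₀ : X.star ((X.inv u).pullback a) (u.pullback a) = 0 := by
    rw [← star_pullback, X.inv_star hp hu]
    exact X.zero_pullback a
  have h₁ := (X.phi_eq_zero_iff (T := T') he hT hp _).1 (X.isKernelPoint_zero hp).2
  rw [← h₀, X.val_star he, congrForm_star hp, hu'] at h₁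
  · rw [X.isKernelPoint_iff hp, X.phi_eq_zero_iff (T := T') he hT hp]
    simpa using h₁
  · rw [← map_pow, ← map_mul, lamCoeff_pow_mul_muCoeff, map_natCast]

/-- The group of `T`-points of the kernel of `φ`. -/
abbrev kernelGroup (hp : p.Prime) (T : Over S) :
    Group {u : LinePoint X.L T // X.IsKernelPoint u} :=
  letI : Mul {u : LinePoint X.L T // X.IsKernelPoint u} :=
    ⟨fun u v ↦ ⟨X.star u.1 v.1, u.2.star X hp v.2⟩⟩
  letI : One {u : LinePoint X.L T // X.IsKernelPoint u} := ⟨⟨0, X.isKernelPoint_zero hp⟩⟩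
  letI : Inv {u : LinePoint X.L T // X.IsKernelPoint u} := ⟨fun u ↦ ⟨X.inv u.1, u.2.inv X hp⟩⟩
  .ofLeftAxioms (fun u v w ↦ Subtype.ext (X.star_assoc u.1 v.1 w.1))
    (fun u ↦ Subtype.ext (X.zero_star u.1)) (fun u ↦ Subtype.ext (X.inv_star hp u.2))

/-- The kernel of `φ`, as a functor. -/
def kernelFunctor (hp : p.Prime) : (Over S)ᵒᵖ ⥤ GrpCat.{u} where
  obj T := letI := X.kernelGroup hp T.unop; .of {u : LinePoint X.L T.unop // X.IsKernelPoint u}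
  map {T T'} a := letI := X.kernelGroup hp T.unop; letI := X.kernelGroup hp T'.unop
    GrpCat.ofHom
      { toFun := fun u ↦ ⟨u.1.pullback a.unop, u.2.pullback X hp a.unop⟩
        map_one' := Subtype.ext (X.zero_pullback a.unop)
        map_mul' := fun u v ↦ Subtype.ext (X.star_pullback u.1 v.1 a.unop) }
  map_id _ := ConcreteCategory.hom_ext _ _ fun u ↦ Subtype.ext (LinePoint.pullback_id u.1)
  map_comp a b := ConcreteCategory.hom_ext _ _ fun u ↦
    Subtype.ext (LinePoint.pullback_comp u.1 a.unop b.unop)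

end Triple

/-! ### The kernel of φ as a Zariski sheaf on all schemes. -/

namespace Triple

variable {p : ℕ} {S : Scheme.{u}} (X : Triple p S)

/-- A point of the kernel of `φ` with values in a scheme `T` without given structure morphism
to `S`. -/
structure AbsolutePoint (T : Scheme.{u}) where
  hom : T ⟶ S
  point : LinePoint X.L (Over.mk hom)
  isKernelPoint : X.IsKernelPoint point

namespace AbsolutePoint

variable {X} {T T' : Scheme.{u}}

/-- The value of a point at a section of `L`. -/
def app (x : X.AbsolutePoint T) {U : S.Opens} {W : T.Opens} (h : W ≤ x.hom ⁻¹ᵁ U) (ξ : Γ(X.L, U)) :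
    Γ(T, W) :=
  res h (x.point.app U ξ)

lemma congr_app {x y : X.AbsolutePoint T} (h : x = y) {U : S.Opens} {W : T.Opens}
    (h₁ : W ≤ x.hom ⁻¹ᵁ U) (h₂ : W ≤ y.hom ⁻¹ᵁ U) (ξ : Γ(X.L, U)) :
    x.app h₁ ξ = y.app h₂ ξ := by
  subst h
  rfl

/-- The type of `point` depends on `hom`; comparing values on opens W inside both preimages avoids
transport along `h`. -/
lemma ext_app {x y : X.AbsolutePoint T} (h : x.hom = y.hom)
    (h' : ∀ (U : S.Opens) (W : T.Opens) (h₁ : W ≤ x.hom ⁻¹ᵁ U) (h₂ : W ≤ y.hom ⁻¹ᵁ U)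
      (ξ : Γ(X.L, U)), x.app h₁ ξ = y.app h₂ ξ) : x = y := by
  obtain ⟨f, x, hx⟩ := x
  obtain ⟨g, y, hy⟩ := y
  obtain rfl : f = g := h
  obtain rfl : x = y := by
    ext U ξ
    exact res_injective le_rfl le_rfl (h' U _ le_rfl le_rfl ξ)
  rfl

lemma exists_mk_eq (x : X.AbsolutePoint T) {f : T ⟶ S} (hf : f = x.hom) :
    ∃ (u : LinePoint X.L (Over.mk f)) (h : X.IsKernelPoint u), x = ⟨f, u, h⟩ := by
  subst hf
  exact ⟨x.point, x.isKernelPoint, rfl⟩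

/-- Pullback of points. -/
def pull (hp : p.Prime) (a : T' ⟶ T) (x : X.AbsolutePoint T) : X.AbsolutePoint T' where
  hom := a ≫ x.hom
  point := x.point.pullback (Over.homMk a)
  isKernelPoint := x.isKernelPoint.pullback X hp _

lemma pull_app (hp : p.Prime) (a : T' ⟶ T) (x : X.AbsolutePoint T) {U : S.Opens} {V : T.Opens}
    {W : T'.Opens} (h : W ≤ (x.pull hp a).hom ⁻¹ᵁ U) (h₁ : V ≤ x.hom ⁻¹ᵁ U) (h₂ : W ≤ a ⁻¹ᵁ V)
    (ξ : Γ(X.L, U)) : (x.pull hp a).app h ξ = pb a V W h₂ (x.app h₁ ξ) :=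
  (res_pb a (U := x.hom ⁻¹ᵁ U) (W := a ⁻¹ᵁ (x.hom ⁻¹ᵁ U)) le_rfl h _).trans
    (pb_res a h₂ h₁ _).symm

lemma pull_id (hp : p.Prime) (x : X.AbsolutePoint T) : x.pull hp (𝟙 T) = x :=
  ext_app (Category.id_comp _) fun U W h₁ h₂ ξ ↦ by
    rw [x.pull_app hp (𝟙 T) h₁ h₂ le_rfl]
    exact pb_of_eq_id rfl (le_rfl : W ≤ (𝟙 T) ⁻¹ᵁ W) _

lemma pull_pull (hp : p.Prime) {T'' : Scheme.{u}} (b : T'' ⟶ T') (a : T' ⟶ T)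
    (x : X.AbsolutePoint T) : (x.pull hp a).pull hp b = x.pull hp (b ≫ a) :=
  ext_app (Category.assoc _ _ _).symm fun U W h₁ h₂ ξ ↦ by
    have h : (x.pull hp a).hom ⁻¹ᵁ U = a ⁻¹ᵁ (x.hom ⁻¹ᵁ U) := rfl
    have h' : W ≤ (b ≫ a) ⁻¹ᵁ (x.hom ⁻¹ᵁ U) := h₂
    rw [(x.pull hp a).pull_app hp b h₁ h.ge h', x.pull_app hp a h.ge le_rfl le_rfl,
      x.pull_app hp (b ≫ a) h₂ le_rfl h']
    exact pb_pb _ _ _ _ (b ≫ a) rfl _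

lemma ext_cover (hp : p.Prime) (𝒰 : Scheme.OpenCover.{v} T) {x y : X.AbsolutePoint T}
    (h : ∀ i, x.pull hp (𝒰.f i) = y.pull hp (𝒰.f i)) : x = y := by
  have hxy : x.hom = y.hom := 𝒰.hom_ext _ _ fun i ↦ congrArg AbsolutePoint.hom (h i)
  obtain ⟨f, x, hx⟩ := x
  obtain ⟨g, y, hy⟩ := y
  obtain rfl : f = g := hxy
  obtain rfl : x = y := by
    ext U ξ
    refine eq_of_pb_eq 𝒰 fun i ↦ ?_
    exact res_injective le_rfl le_rfl (congr_app (h i) le_rfl le_rfl ξ)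
  rfl

/-- The structure morphisms glue first, then, for each section ξ of L, the functions u_i(ξ).
Additivity, linearity, compatibility with restriction and the kernel condition can all be tested on
the cover. -/
lemma exists_glue (hp : p.Prime) (𝒰 : Scheme.OpenCover.{v} T)
    (x : ∀ i, X.AbsolutePoint (𝒰.X i))
    (hx : ∀ i j, (x i).pull hp (pullback.fst (𝒰.f i) (𝒰.f j)) =
      (x j).pull hp (pullback.snd (𝒰.f i) (𝒰.f j))) :
    ∃ y : X.AbsolutePoint T, ∀ i, y.pull hp (𝒰.f i) = x i := by
  obtain ⟨f, hf⟩ : ∃ f : T ⟶ S, ∀ i, 𝒰.f i ≫ f = (x i).hom :=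
    ⟨𝒰.glueMorphisms (fun i ↦ (x i).hom) fun i j ↦ congrArg AbsolutePoint.hom (hx i j),
      fun i ↦ 𝒰.ι_glueMorphisms _ _ i⟩
  choose v hv hvx using fun i ↦ (x i).exists_mk_eq (hf i)
  have hglue (U : S.Opens) (ξ : Γ(X.L, U)) : ∃ s : Γ(T, f ⁻¹ᵁ U), ∀ i,
      pb (𝒰.f i) (f ⁻¹ᵁ U) _ le_rfl s = (v i).app U ξ :=
    exists_pb_eq 𝒰 (f ⁻¹ᵁ U) _ fun i j W h₁ h₂ ↦ by
      let y (k) : X.AbsolutePoint (𝒰.X k) := ⟨𝒰.f k ≫ f, v k, hv k⟩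
      have hy (k) (ξ : Γ(X.L, U)) : (y k).app (W := 𝒰.f k ⁻¹ᵁ (f ⁻¹ᵁ U)) le_rfl ξ =
        (v k).app U ξ := res_self _
      have h : (y i).pull hp (pullback.fst (𝒰.f i) (𝒰.f j)) =
          (y j).pull hp (pullback.snd (𝒰.f i) (𝒰.f j)) := by
        have := hx i j
        rwa [hvx i, hvx j] at this
      have := congr_app h (U := U) (W := W) h₁ h₂ ξ
      rw [(y i).pull_app hp _ (V := 𝒰.f i ⁻¹ᵁ (f ⁻¹ᵁ U)) h₁ le_rfl h₁,
        (y j).pull_app hp _ (V := 𝒰.f j ⁻¹ᵁ (f ⁻¹ᵁ U)) h₂ le_rfl h₂, hy, hy] at this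
      exact this
  choose s hs using hglue
  let u : LinePoint X.L (Over.mk f) :=
    { app U := AddMonoidHom.mk' (s U) fun ξ η ↦ eq_of_pb_eq 𝒰 fun i ↦ by
        rw [map_add, hs, hs, hs, map_add]
        rfl
      app_smul U r ξ := eq_of_pb_eq 𝒰 fun i ↦ by
        change pb (𝒰.f i) (f ⁻¹ᵁ U) _ le_rfl (s U (r • ξ)) =
          pb (𝒰.f i) (f ⁻¹ᵁ U) _ le_rfl (f.app U r * s U ξ)
        rw [hs, map_mul, hs, LinePoint.app_smul', app_eq_pb, pb_pb _ _ _ _ (𝒰.f i ≫ f) rfl]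
        rfl
      app_map {V U} k ξ := eq_of_pb_eq 𝒰 fun i ↦ by
        change pb (𝒰.f i) (f ⁻¹ᵁ V) _ le_rfl (s V (resM X.L k.le ξ)) =
          pb (𝒰.f i) (f ⁻¹ᵁ V) _ le_rfl (res (f.preimage_mono k.le) (s U ξ))
        have h := congrArg (res (Scheme.Hom.preimage_mono (𝒰.f i) (f.preimage_mono k.le)))
          (hs U ξ i)
        rw [res_pb] at h
        rw [hs, LinePoint.app_res, pb_res, h]
        rfl }
  have hu (i) : u.pullback (Over.homMk (𝒰.f i) : Over.mk (𝒰.f i ≫ f) ⟶ Over.mk f) = v i := by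
    ext U ξ
    exact hs U ξ i
  refine ⟨⟨f, u, X.isKernelPoint_of_cover hp 𝒰 fun i ↦ (hu i) ▸ hv i⟩, fun i ↦ ?_⟩
  rw [hvx i, pull]
  congr 1
  exact hu i

end AbsolutePoint

/-- The kernel of `φ`, as a functor on schemes. -/
def absoluteFunctor (hp : p.Prime) : Scheme.{u}ᵒᵖ ⥤ Type u where
  obj T := X.AbsolutePoint T.unop
  map a := ↾(AbsolutePoint.pull hp a.unop)
  map_id T := by ext x; exact x.pull_id hp
  map_comp a b := by ext x; exact (x.pull_pull hp b.unop a.unop).symm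

lemma isSheaf_absoluteFunctor (hp : p.Prime) :
    Presheaf.IsSheaf Scheme.zariskiTopology (X.absoluteFunctor hp) := by
  rw [isSheaf_iff_isSheaf_of_type]
  refine (Precoverage.isSheaf_toGrothendieck_iff_of_isStableUnderBaseChange _).2 fun T R hR ↦ ?_
  obtain ⟨(𝒰 : T.OpenCover), rfl⟩ := Scheme.exists_cover_of_mem_pretopology hR
  rw [Presieve.isSheafFor_arrows_iff_pullbacks]
  intro x hx
  obtain ⟨y, hy⟩ := AbsolutePoint.exists_glue hp 𝒰 x hx
  exact ⟨y, hy, fun z hz ↦ AbsolutePoint.ext_cover hp 𝒰 fun i ↦ (hz i).trans (hy i).symm⟩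

end Triple

lemma pb_top {X Y : Scheme.{u}} (f : X ⟶ Y) : pb f ⊤ ⊤ (le_preimage_top f) = f.appTop.hom :=
  congrArg CommRingCat.Hom.hom (f.appLE_eq_app (U := ⊤))

/-! ### The scheme of roots of a polynomial over an affine scheme -/

section RootScheme

/-- `AdjoinRoot P` as an object of `CommRingCat`. -/
def rootRing {R : CommRingCat.{u}} (P : Polynomial R) : CommRingCat.{u} := .of (AdjoinRoot P)

namespace rootRing

variable {R : CommRingCat.{u}} (P : Polynomial R)

/-- The structure morphism of `rootRing P`. -/
def of : R ⟶ rootRing P := CommRingCat.ofHom (AdjoinRoot.of P)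

/-- The root in `rootRing P`. -/
def root : rootRing P := AdjoinRoot.root P

lemma eval₂_root : P.eval₂ (of P).hom (root P) = 0 := AdjoinRoot.eval₂_root P

variable {P}

/-- The universal property of `rootRing P`. -/
def lift {A : CommRingCat.{u}} (f : R ⟶ A) (b : A) (h : P.eval₂ f.hom b = 0) : rootRing P ⟶ A :=
  CommRingCat.ofHom (AdjoinRoot.lift f.hom b h)

@[simp]
lemma of_lift {A : CommRingCat.{u}} (f : R ⟶ A) (b : A) (h : P.eval₂ f.hom b = 0) :
    of P ≫ lift f b h = f := by
  ext x
  exact AdjoinRoot.lift_of h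

lemma lift_root {A : CommRingCat.{u}} (f : R ⟶ A) (b : A) (h : P.eval₂ f.hom b = 0) :
    lift f b h (root P) = b := AdjoinRoot.lift_root h

lemma hom_ext {A : CommRingCat.{u}} {f g : rootRing P ⟶ A} (h : of P ≫ f = of P ≫ g)
    (h' : f (root P) = g (root P)) : f = g :=
  CommRingCat.hom_ext (AdjoinRoot.ringHom_ext (congrArg CommRingCat.Hom.hom h) h')

end rootRing

variable {V : Scheme.{u}} [IsAffine V] (P : Polynomial Γ(V, ⊤))

/-- The scheme of roots of a polynomial. -/
abbrev rootScheme : Scheme.{u} := Spec (rootRing P)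

namespace rootScheme

/-- The universal root. -/
def root : Γ(rootScheme P, ⊤) := (Scheme.ΓSpecIso (rootRing P)).inv (rootRing.root P)

/-- The projection of the scheme of roots. -/
def proj : rootScheme P ⟶ V := Spec.map (rootRing.of P) ≫ V.isoSpec.inv

lemma _root_.AlgebraicGeometry.Scheme.isoSpec_inv_appTop :
    V.isoSpec.inv.appTop = (Scheme.ΓSpecIso Γ(V, ⊤)).inv := by
  rw [← cancel_epi (Scheme.ΓSpecIso Γ(V, ⊤)).hom, Iso.hom_inv_id, ← V.toSpecΓ_appTop,
    ← Scheme.Hom.comp_appTop]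
  have : V.isoSpec.inv ≫ V.toSpecΓ = 𝟙 _ := V.isoSpec.inv_hom_id
  rw [this]
  rfl

lemma appTop_proj : (proj P).appTop = rootRing.of P ≫ (Scheme.ΓSpecIso (rootRing P)).inv := by
  rw [proj, Scheme.Hom.comp_appTop, V.isoSpec_inv_appTop]
  exact (Scheme.ΓSpecIso_inv_naturality _).symm

lemma eval₂_root : P.eval₂ (pb (proj P) ⊤ ⊤ (le_preimage_top _)) (root P) = 0 := by
  rw [pb_top, appTop_proj, CommRingCat.hom_comp, root]
  exact (Polynomial.hom_eval₂ _ _ _ _).symm.trans (by rw [rootRing.eval₂_root, map_zero])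

/-- Morphisms to an affine scheme are ring maps into global functions, and `AdjoinRoot` has the
universal property of a root. -/
lemma existsUnique_hom {T : Scheme.{u}} (a : T ⟶ V) (b : Γ(T, ⊤))
    (h : P.eval₂ (pb a ⊤ ⊤ (le_preimage_top _)) b = 0) :
    ∃! c : T ⟶ rootScheme P, c ≫ proj P = a ∧ pb c ⊤ ⊤ (le_preimage_top _) (root P) = b := by
  rw [pb_top] at h
  let c : T ⟶ rootScheme P := T.toSpecΓ ≫ Spec.map (rootRing.lift _ b h)
  have hc : (Scheme.ΓSpecIso (rootRing P)).inv ≫ c.appTop = rootRing.lift _ b h := by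
    rw [Scheme.Hom.comp_appTop, Scheme.toSpecΓ_appTop, ← Scheme.ΓSpecIso_inv_naturality_assoc,
      Iso.inv_hom_id, Category.comp_id]
  refine ⟨c, ⟨ext_of_isAffine ?_, ?_⟩, fun c' ⟨h₁, h₂⟩ ↦ ext_of_isAffine ?_⟩
  · rw [Scheme.Hom.comp_appTop, appTop_proj, Category.assoc, hc, rootRing.of_lift]
  · rw [pb_top]
    exact (ConcreteCategory.congr_hom hc (rootRing.root P)).trans (rootRing.lift_root _ b h)
  · rw [← cancel_epi (Scheme.ΓSpecIso (rootRing P)).inv, hc]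
    refine rootRing.hom_ext ?_ ?_
    · rw [rootRing.of_lift, ← Category.assoc, ← appTop_proj, ← h₁, Scheme.Hom.comp_appTop]
    · rw [pb_top] at h₂
      exact h₂.trans (rootRing.lift_root _ b h).symm

end rootScheme

end RootScheme

/-! ### Affine charts of the kernel. -/

namespace Triple

variable {p : ℕ} {S : Scheme.{u}} (X : Triple p S)

lemma top_le_preimage_of_comp {U : S.Opens} {V T : Scheme.{u}} (j : V ⟶ S) (hj : ⊤ ≤ j ⁻¹ᵁ U)
    (a : T ⟶ V) {f : T ⟶ S} (hf : a ≫ j = f) : ⊤ ≤ f ⁻¹ᵁ U := by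
  subst hf
  exact fun x _ ↦ hj (x := a x) trivial

section Chart

variable {U : S.Opens} {e : Γ(X.L, U)} (he : IsTrivialization e) {V : Scheme.{u}}
  (j : V ⟶ S) (hj : ⊤ ≤ j ⁻¹ᵁ U)

/-- The equation of the kernel of `φ` over a trivialization. -/
def chartPoly : Polynomial Γ(V, ⊤) :=
  congrPoly p (pb j U ⊤ hj (X.lamCoeff he)) (pb j U ⊤ hj (X.muCoeff e))

lemma isKernelPoint_iff_eval₂ (hp : p.Prime) {T : Over S} (a : T.left ⟶ V) (ha : a ≫ j = T.hom)
    (u : LinePoint X.L T) :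
    X.IsKernelPoint u ↔ (X.chartPoly he j hj).eval₂ (pb a ⊤ ⊤ (le_preimage_top _))
      (u.val e (top_le_preimage_of_comp j hj a ha)) = 0 := by
  rw [X.isKernelPoint_iff hp, X.phi_eq_zero_iff he (top_le_preimage_of_comp j hj a ha) hp,
    chartPoly, eval₂_congrPoly, pb_pb _ _ _ _ T.hom ha, pb_pb _ _ _ _ T.hom ha]

variable [IsAffine V]

/-- The part of the kernel of `φ` over an affine scheme over which `L` is trivialized. -/
abbrev chart : Scheme.{u} := rootScheme (X.chartPoly he j hj)

/-- The projection of a chart. -/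
abbrev chartProj : X.chart he j hj ⟶ V := rootScheme.proj (X.chartPoly he j hj)

/-- The tautological point over a chart. -/
def chartPoint : LinePoint X.L (Over.mk (X.chartProj he j hj ≫ j)) :=
  .ofVal he (top_le_preimage_of_comp j hj (X.chartProj he j hj) rfl) (rootScheme.root _)

lemma isKernelPoint_chartPoint (hp : p.Prime) : X.IsKernelPoint (X.chartPoint he j hj) := by
  rw [X.isKernelPoint_iff_eval₂ he j hj hp (X.chartProj he j hj) rfl, chartPoint,
    LinePoint.val_ofVal]
  exact rootScheme.eval₂_root _

/-- Over a trivialization a line bundle point amounts to its value at `e`, and the kernel condition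
says that this value is a root of `chartPoly`. -/
lemma existsUnique_chart_hom (hp : p.Prime) {T : Over S} (a : T.left ⟶ V) (ha : a ≫ j = T.hom)
    {u : LinePoint X.L T} (hu : X.IsKernelPoint u) :
    ∃! c : T ⟶ Over.mk (X.chartProj he j hj ≫ j), c.left ≫ X.chartProj he j hj = a ∧
      (X.chartPoint he j hj).pullback c = u := by
  have key (c : T ⟶ Over.mk (X.chartProj he j hj ≫ j)) :
      (X.chartPoint he j hj).pullback c = u ↔
        pb c.left ⊤ ⊤ (le_preimage_top _) (rootScheme.root _) =
          u.val e (top_le_preimage_of_comp j hj a ha) := by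
    have h := (X.chartPoint he j hj).val_pullback e
      (top_le_preimage_of_comp j hj (X.chartProj he j hj) rfl) c
      (top_le_preimage_of_comp j hj a ha)
    rw [chartPoint, LinePoint.val_ofVal] at h
    rw [chartPoint]
    exact ⟨fun h' ↦ by rw [← h, h'], fun h' ↦ LinePoint.ext_val he _ (h.trans h')⟩
  obtain ⟨c, ⟨hc, hc'⟩, h⟩ := rootScheme.existsUnique_hom _ a _
    ((X.isKernelPoint_iff_eval₂ he j hj hp a ha u).1 hu)
  refine ⟨Over.homMk c (by simp [reassoc_of% hc, ha]), ⟨hc, (key _).2 hc'⟩, fun d ⟨hd, hd'⟩ ↦ ?_⟩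
  ext1
  exact h d.left ⟨hd, (key d).1 hd'⟩

end Chart

end Triple

/-! ### Representability and the group structure. -/

namespace Triple

variable {p : ℕ} {S : Scheme.{u}} (X : Triple p S)

lemma AbsolutePoint.pull_eq_mk_iff {X : Triple p S} (hp : p.Prime) {T T' : Scheme.{u}}
    (x : X.AbsolutePoint T) (a : T' ⟶ T) {f : T' ⟶ S} (hf : a ≫ x.hom = f)
    (u : LinePoint X.L (Over.mk f)) (hu : X.IsKernelPoint u) :
    x.pull hp a = ⟨f, u, hu⟩ ↔
      x.point.pullback (Over.homMk a hf : Over.mk f ⟶ Over.mk x.hom) = u := by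
  subst hf
  rw [pull, AbsolutePoint.mk.injEq]
  simp only [heq_eq_eq, true_and]

/-- The structure morphism of `absoluteFunctor`. -/
def absoluteFunctorHom (hp : p.Prime) : X.absoluteFunctor hp ⟶ yoneda.obj S where
  app _ := ↾fun x ↦ x.hom
  naturality _ _ _ := rfl

section Chart

variable {U : S.Opens} {e : Γ(X.L, U)} (he : IsTrivialization e) {V : Scheme.{u}} [IsAffine V]
  (j : V ⟶ S) (hj : ⊤ ≤ j ⁻¹ᵁ U)

/-- The tautological point over a chart. -/
def chartAbsolutePoint (hp : p.Prime) : X.AbsolutePoint (X.chart he j hj) :=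
  ⟨X.chartProj he j hj ≫ j, X.chartPoint he j hj, X.isKernelPoint_chartPoint he j hj hp⟩

/-- A chart as a morphism to the kernel of `φ`. -/
def chartHom (hp : p.Prime) : yoneda.obj (X.chart he j hj) ⟶ X.absoluteFunctor hp where
  app T := ↾fun c ↦ (X.chartAbsolutePoint he j hj hp).pull hp c
  naturality _ _ a := by
    ext c
    exact ((X.chartAbsolutePoint he j hj hp).pull_pull hp a.unop c).symm

lemma existsUnique_pull_eq (hp : p.Prime) {T : Scheme.{u}} (x : X.AbsolutePoint T) (a : T ⟶ V)
    (ha : a ≫ j = x.hom) : ∃! c : T ⟶ X.chart he j hj, c ≫ X.chartProj he j hj = a ∧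
      (X.chartAbsolutePoint he j hj hp).pull hp c = x := by
  obtain ⟨c, ⟨hc, hc'⟩, h⟩ := X.existsUnique_chart_hom he j hj hp (T := Over.mk x.hom) a ha
    x.isKernelPoint
  have key (d : T ⟶ X.chart he j hj) (hd : d ≫ (X.chartAbsolutePoint he j hj hp).hom = x.hom) :=
    AbsolutePoint.pull_eq_mk_iff hp (X.chartAbsolutePoint he j hj hp) d hd x.point x.isKernelPoint
  refine ⟨c.left, ⟨hc, (key c.left (Over.w c)).2 hc'⟩, fun d ⟨hd, hd'⟩ ↦ ?_⟩
  have hw : d ≫ (X.chartAbsolutePoint he j hj hp).hom = x.hom := congrArg AbsolutePoint.hom hd'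
  exact congrArg (fun k : Over.mk x.hom ⟶ Over.mk (X.chartProj he j hj ≫ j) ↦ k.left)
    (h (Over.homMk d hw) ⟨hd, (key d hw).1 hd'⟩)

/-- Used to transfer openness: if `j` is an open immersion, its base change `chartHom` is an open
subfunctor. -/
lemma isPullback_chartHom (hp : p.Prime) :
    IsPullback (X.chartHom he j hj hp) (yoneda.map (X.chartProj he j hj))
      (X.absoluteFunctorHom hp) (yoneda.map j) := by
  refine .of_forall_isPullback_app fun T ↦ (Types.isPullback_iff _ _ _ _).2 ⟨?_, ?_, ?_⟩
  · ext (c : T.unop ⟶ X.chart he j hj)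
    exact (Category.assoc c (X.chartProj he j hj) j).symm
  · rintro (c : T.unop ⟶ X.chart he j hj) (c' : T.unop ⟶ X.chart he j hj) ⟨h, h'⟩
    exact (X.existsUnique_pull_eq he j hj hp
      ((X.chartAbsolutePoint he j hj hp).pull hp c') (c' ≫ X.chartProj he j hj)
      (Category.assoc _ _ _)).unique ⟨h', h⟩ ⟨rfl, rfl⟩
  · rintro (x : X.AbsolutePoint T.unop) (a : T.unop ⟶ V) (h : x.hom = a ≫ j)
    obtain ⟨c, ⟨hc, hc'⟩, -⟩ := X.existsUnique_pull_eq he j hj hp x a h.symm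
    exact ⟨c, hc', hc⟩

lemma presheaf_chartHom (hp : p.Prime) [IsOpenImmersion j] :
    IsOpenImmersion.presheaf (X.chartHom he j hj hp) := by
  have := MorphismProperty.relative_isStableUnderBaseChange (F := yoneda (C := Scheme.{u}))
    @IsOpenImmersion
  exact MorphismProperty.of_isPullback (P := IsOpenImmersion.presheaf)
    (X.isPullback_chartHom he j hj hp).flip
    (MorphismProperty.relative_map ‹IsOpenImmersion j›)

end Chart

/-- The kernel of `φ` is representable by a scheme. -/
lemma isRepresentable_absoluteFunctor (hp : p.Prime) : (X.absoluteFunctor hp).IsRepresentable := by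
  choose U hU e he using X.isInvertible
  replace he (s) : IsTrivialization (e s) := he s
  choose W hW hsW hWU using fun s : S ↦ exists_isAffineOpen_mem_and_subset (hU s)
  have hW' (s) : IsAffine (W s) := hW s
  have hj (s) : ⊤ ≤ (W s).ι ⁻¹ᵁ U s := fun x _ ↦ hWU s x.2
  let f (s : S) : yoneda.obj (X.chart (he s) (W s).ι (hj s)) ⟶ X.absoluteFunctor hp :=
    X.chartHom (he s) (W s).ι (hj s) hp
  have hf (s : S) : IsOpenImmersion.presheaf (f s) := X.presheaf_chartHom _ _ _ hp
  -- Near t, a point x lifts to the chart with index x.hom(t): on the preimage of the affine open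
  -- attached to that index, x.hom factors through it.
  have : Presheaf.IsLocallySurjective Scheme.zariskiTopology (Sigma.desc f) := by
    refine ⟨fun {T} (x : X.AbsolutePoint T) ↦ ?_⟩
    let O : T → T.Opens := fun t ↦ x.hom ⁻¹ᵁ W (x.hom t)
    let 𝒰 := T.openCoverOfIsOpenCover O
      (.mk (top_unique fun t _ ↦ TopologicalSpace.Opens.mem_iSup.2 ⟨t, hsW _⟩))
    refine GrothendieckTopology.superset_covering _ ?_ 𝒰.mem_grothendieckTopology
    rw [Sieve.ofArrows, Sieve.generate_le_iff]
    rintro _ _ ⟨t : T⟩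
    let y := x.pull hp (𝒰.f t)
    have hy : ∃ a : 𝒰.X t ⟶ W (x.hom t), a ≫ (W (x.hom t)).ι = y.hom := by
      refine ⟨IsOpenImmersion.lift (W (x.hom t)).ι y.hom ?_, IsOpenImmersion.lift_fac _ _ _⟩
      rintro _ ⟨z, rfl⟩
      have hz : z.1 ∈ O t := z.2
      rw [Scheme.Opens.range_ι]
      exact hz
    obtain ⟨a, ha⟩ := hy
    obtain ⟨c, ⟨-, hc⟩, -⟩ := X.existsUnique_pull_eq (he (x.hom t)) (W (x.hom t)).ι (hj _) hp y a ha
    refine ⟨(Sigma.ι (fun s ↦ yoneda.obj (X.chart (he s) (W s).ι (hj s))) (x.hom t)).app _ c, ?_⟩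
    rw [← NatTrans.comp_app_apply, Sigma.ι_desc]
    exact hc
  exact Scheme.LocalRepresentability.isRepresentable (F := ⟨_, X.isSheaf_absoluteFunctor hp⟩) hf

/-- The congruence group scheme exists. -/
lemma exists_congruenceGroupScheme (hp : p.Prime) :
    ∃ (H : Scheme.{u}) (_ : H.Over S) (_ : GrpObj (H.asOver S)),
      Nonempty (X.CongruenceGroupScheme H) := by
  obtain ⟨H, ⟨α⟩⟩ := X.isRepresentable_absoluteFunctor hp
  -- The universal point supplies the structure morphism of H; S-morphisms T ⟶ H are then the
  -- absolute points of T with the prescribed `hom`.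
  let y : X.AbsolutePoint H := α.homEquiv (𝟙 H)
  let _ : H.Over S := ⟨y.hom⟩
  have hα {T : Scheme.{u}} (a : T ⟶ H) : α.homEquiv a = y.pull hp a := α.homEquiv_eq a
  let β (T : Over S) (h : T ⟶ H.asOver S) : {u : LinePoint X.L T // X.IsKernelPoint u} :=
    ⟨LinePoint.pullback (T := H.asOver S) y.point h,
      IsKernelPoint.pullback X hp (T := H.asOver S) y.isKernelPoint h⟩
  have hβ (T : Over S) : Function.Bijective (β T) := by
    constructor
    · intro h h' hh
      ext1
      apply α.homEquiv.injective
      have (k : T ⟶ H.asOver S) := AbsolutePoint.pull_eq_mk_iff hp y k.left (Over.w k)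
        (β T k).1 (β T k).2
      refine (hα _).trans (((this h).2 rfl).trans (Eq.trans ?_ (((this h').2 rfl).symm.trans
        (hα _).symm)))
      congr 1
      exact congrArg Subtype.val hh
    · rintro ⟨u, hu⟩
      obtain ⟨g, hg⟩ := α.homEquiv.surjective (show X.AbsolutePoint T.left from ⟨T.hom, u, hu⟩)
      rw [hα] at hg
      have hg' : g ≫ y.hom = T.hom := congrArg AbsolutePoint.hom hg
      exact ⟨Over.homMk g hg', Subtype.ext
        ((AbsolutePoint.pull_eq_mk_iff hp y g hg' u hu).1 hg)⟩
  let γ : (X.kernelFunctor hp ⋙ forget GrpCat).RepresentableBy (H.asOver S) :=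
    { homEquiv := .ofBijective _ (hβ _)
      homEquiv_comp a h := Subtype.ext (LinePoint.pullback_comp _ _ _) }
  let G := GrpObj.ofRepresentableBy (H.asOver S) _ γ
  refine ⟨H, inferInstance, G, ⟨⟨fun T ↦ .ofBijective _ (hβ T), fun a h ↦ ?_, fun {T} h h' ↦ ?_⟩⟩⟩
  · exact LinePoint.pullback_comp _ _ _
  · have := ((yonedaGrpObjIsoOfRepresentableBy (H.asOver S) _ γ).hom.app (op T)).hom.map_mul h h'
    exact congrArg Subtype.val this

end Triple

/-! ### Finiteness, flatness and rank of the scheme of roots. -/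

namespace rootRing

variable {R : CommRingCat.{u}} {P : Polynomial R}

lemma finite_of (hP : P.Monic) : (of P).hom.Finite :=
  have := hP.finite_adjoinRoot
  RingHom.finite_algebraMap.2 this

lemma flat_of (hP : P.Monic) : (of P).hom.Flat :=
  have := hP.free_adjoinRoot
  have : Module.Flat R (AdjoinRoot P) := inferInstance
  RingHom.flat_algebraMap_iff.2 this

lemma finitePresentation_of : (of P).hom.FinitePresentation :=
  RingHom.finitePresentation_algebraMap.2
    (Algebra.FinitePresentation.quotient (A := Polynomial R) ⟨{P}, by simp⟩)

end rootRing

namespace rootScheme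

variable {V : Scheme.{u}} [IsAffine V] {P : Polynomial Γ(V, ⊤)}

lemma isFinite_proj (hP : P.Monic) : IsFinite (proj P) :=
  have := (IsFinite.SpecMap_iff _).2 (rootRing.finite_of hP)
  MorphismProperty.comp_mem _ _ _ this inferInstance

lemma flat_proj (hP : P.Monic) : Flat (proj P) :=
  have := Flat.SpecMap_iff.2 (rootRing.flat_of hP)
  MorphismProperty.comp_mem _ _ _ this inferInstance

lemma locallyOfFinitePresentation_proj : LocallyOfFinitePresentation (proj P) :=
  have := (LocallyOfFinitePresentation.SpecMap_iff _).2 (rootRing.finitePresentation_of (P := P))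
  MorphismProperty.comp_mem _ _ _ this inferInstance

lemma finrank_proj (hP : P.Monic) (s : V) : (proj P).finrank s = P.natDegree := by
  have := (IsFinite.SpecMap_iff _).2 (rootRing.finite_of hP)
  have := Flat.SpecMap_iff.2 (rootRing.flat_of hP)
  have h : IsPullback (𝟙 _) (proj P) (Spec.map (rootRing.of P)) V.isoSpec.hom :=
    .of_horiz_isIso ⟨by simp [proj]⟩
  rw [Scheme.Hom.finrank_of_isPullback _ _ _ _ h]
  have := hP.finite_adjoinRoot
  have := hP.free_adjoinRoot
  have : Nontrivial Γ(V, ⊤) := by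
    have : Nonempty (PrimeSpectrum Γ(V, ⊤)) := ⟨V.isoSpec.hom s⟩
    exact PrimeSpectrum.nonempty_iff_nontrivial.1 this
  refine (Scheme.Hom.finrank_SpecMap_algebraMap Γ(V, ⊤) (AdjoinRoot P) _).trans ?_
  rw [Module.rankAtStalk_eq_finrank_of_free]
  exact finrank_quotient_span_eq_natDegree' hP

end rootScheme

/-! ### Any congruence group scheme is finite locally free of order p. -/

namespace Triple.CongruenceGroupScheme

variable {p : ℕ} {S : Scheme.{u}} {X : Triple p S} {H : Scheme.{u}} [H.Over S]
  [GrpObj (H.asOver S)] (c : X.CongruenceGroupScheme H)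

/-- The tautological point of a congruence group scheme. -/
def absolutePoint : X.AbsolutePoint H :=
  ⟨H ↘ S, (c.points (H.asOver S) (𝟙 _)).1, (c.points (H.asOver S) (𝟙 _)).2⟩

lemma points_eq {T : Over S} (h : T ⟶ H.asOver S) :
    (c.points T h).1 = LinePoint.pullback (T := H.asOver S) c.absolutePoint.point h := by
  conv_lhs => rw [← Category.comp_id h]
  exact c.points_comp h (𝟙 _)

lemma pull_left (hp : p.Prime) {T : Over S} (h : T ⟶ H.asOver S) :
    c.absolutePoint.pull hp h.left = ⟨T.hom, (c.points T h).1, (c.points T h).2⟩ :=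
  (AbsolutePoint.pull_eq_mk_iff hp c.absolutePoint h.left (Over.w h) (c.points T h).1
    (c.points T h).2).2 (c.points_eq h).symm

/-- Summing the given bijections over all S-structures on T shows that H represents
`absoluteFunctor`. Every congruence group scheme, not only the constructed one, can therefore be
studied on the charts. -/
lemma bijective_pull (hp : p.Prime) (T : Scheme.{u}) :
    Function.Bijective fun a : T ⟶ H ↦ c.absolutePoint.pull hp a := by
  constructor
  · intro a b h
    have hw : a ≫ (H ↘ S) = b ≫ (H ↘ S) := congrArg AbsolutePoint.hom h
    let k : Over.mk (b ≫ (H ↘ S)) ⟶ H.asOver S := Over.homMk a hw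
    let l : Over.mk (b ≫ (H ↘ S)) ⟶ H.asOver S := Over.homMk b rfl
    have h' := (c.pull_left hp k).symm.trans (Eq.trans h (c.pull_left hp l))
    rw [AbsolutePoint.mk.injEq] at h'
    have : k = l := (c.points _).injective (Subtype.ext (eq_of_heq h'.2))
    exact congrArg (fun k : Over.mk (b ≫ (H ↘ S)) ⟶ H.asOver S ↦ k.left) this
  · rintro ⟨f, u, hu⟩
    obtain ⟨k, hk⟩ := (c.points (Over.mk f)).surjective ⟨u, hu⟩
    refine ⟨k.left, (c.pull_left hp k).trans ?_⟩
    simp only [hk]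
    rfl

section Chart

variable {U : S.Opens} {e : Γ(X.L, U)} (he : IsTrivialization e) {V : Scheme.{u}} [IsAffine V]
  (j : V ⟶ S) (hj : ⊤ ≤ j ⁻¹ᵁ U)

/-- A map to H with a lift of its S-structure to V is a kernel point over V, and
`existsUnique_pull_eq` makes this a unique map to the chart. -/
lemma exists_isPullback_chartProj (c : X.CongruenceGroupScheme H) (hp : p.Prime) :
    ∃ (d : X.chart he j hj ⟶ H) (w : d ≫ (H ↘ S) = X.chartProj he j hj ≫ j),
      (c.points (Over.mk (X.chartProj he j hj ≫ j)) (Over.homMk d w)).1 = X.chartPoint he j hj ∧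
        IsPullback d (X.chartProj he j hj) (H ↘ S) j := by
  obtain ⟨d', hd'⟩ := (c.points (Over.mk (X.chartProj he j hj ≫ j))).surjective
    ⟨X.chartPoint he j hj, X.isKernelPoint_chartPoint he j hj hp⟩
  let d : X.chart he j hj ⟶ H := d'.left
  have hd : c.absolutePoint.pull hp d = X.chartAbsolutePoint he j hj hp := by
    refine (c.pull_left hp d').trans ?_
    rw [hd']
    rfl
  have w : d ≫ (H ↘ S) = X.chartProj he j hj ≫ j := congrArg AbsolutePoint.hom hd
  have huniv {T : Scheme.{u}} (a : T ⟶ H) (b : T ⟶ V) (hab : a ≫ (H ↘ S) = b ≫ j) :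
      ∃! k : T ⟶ X.chart he j hj, k ≫ X.chartProj he j hj = b ∧ k ≫ d = a := by
    obtain ⟨k, ⟨hk, hk'⟩, h⟩ := X.existsUnique_pull_eq he j hj hp (c.absolutePoint.pull hp a) b
      hab.symm
    have key (k : T ⟶ X.chart he j hj) :
        (X.chartAbsolutePoint he j hj hp).pull hp k = c.absolutePoint.pull hp a ↔ k ≫ d = a := by
      rw [← hd, AbsolutePoint.pull_pull]
      exact (c.bijective_pull hp T).1.eq_iff
    exact ⟨k, ⟨hk, (key k).1 hk'⟩, fun l hl ↦ h l ⟨hl.1, (key l).2 hl.2⟩⟩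
  refine ⟨d, w, congrArg Subtype.val hd', ⟨w⟩, ⟨PullbackCone.IsLimit.mk w
    (fun s ↦ (huniv s.fst s.snd s.condition).choose)
    (fun s ↦ (huniv s.fst s.snd s.condition).choose_spec.1.2)
    (fun s ↦ (huniv s.fst s.snd s.condition).choose_spec.1.1)
    fun s m h₁ h₂ ↦ (huniv s.fst s.snd s.condition).choose_spec.2 m ⟨h₂, h₁⟩⟩⟩

end Chart

/-- Over the members of an affine open cover of S, the structure morphism becomes the projection of
a chart. -/
lemma of_chart (c : X.CongruenceGroupScheme H) (hp : p.Prime)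
    (P : MorphismProperty Scheme.{u}) [IsZariskiLocalAtTarget P]
    (h : ∀ {V : Scheme.{u}} [IsAffine V] {Q : Polynomial Γ(V, ⊤)}, Q.Monic →
      P (rootScheme.proj Q)) : P (H ↘ S) := by
  choose U hU e he using X.isInvertible
  replace he (s) : IsTrivialization (e s) := he s
  choose W hW hsW hWU using fun s : S ↦ exists_isAffineOpen_mem_and_subset (hU s)
  have hW' (s) : IsAffine (W s) := hW s
  have hj (s) : ⊤ ≤ (W s).ι ⁻¹ᵁ U s := fun x _ ↦ hWU s x.2
  let 𝒰 := S.openCoverOfIsOpenCover W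
    (.mk (top_unique fun s _ ↦ TopologicalSpace.Opens.mem_iSup.2 ⟨s, hsW _⟩))
  refine IsZariskiLocalAtTarget.of_openCover 𝒰 fun (s : S) ↦ ?_
  obtain ⟨d, -, -, hd⟩ := c.exists_isPullback_chartProj (he s) (W s).ι (hj s) hp
  change P (pullback.snd (H ↘ S) (W s).ι)
  rw [← hd.isoPullback_inv_snd, P.cancel_left_of_respectsIso]
  exact h (monic_congrPoly hp.pos _ _)

lemma isFiniteLocallyFreeOfOrder (c : X.CongruenceGroupScheme H) (hp : p.Prime) :
    IsFiniteLocallyFreeOfOrder p S H := by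
  have : IsZariskiLocalAtTarget @IsFinite.{u} :=
    @HasAffineProperty.instIsZariskiLocalAtTarget _ _
      IsFinite.instHasAffinePropertyAndIsAffineFiniteCarrierObjOppositeOpensCarrierCarrierCommRingCatPresheafOpOpensTopHomAppTop
  have : IsZariskiLocalAtTarget @Flat.{u} := HasRingHomProperty.instIsZariskiLocalAtTarget _
  have : IsZariskiLocalAtTarget @LocallyOfFinitePresentation.{u} :=
    HasRingHomProperty.instIsZariskiLocalAtTarget _
  have h₁ : IsFinite (H ↘ S) := c.of_chart hp @IsFinite rootScheme.isFinite_proj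
  have h₂ : Flat (H ↘ S) := c.of_chart hp @Flat rootScheme.flat_proj
  refine ⟨h₁, h₂, c.of_chart hp @LocallyOfFinitePresentation fun _ ↦
    rootScheme.locallyOfFinitePresentation_proj, fun s ↦ ?_⟩
  obtain ⟨U, hU, e, he⟩ := X.isInvertible s
  replace he : IsTrivialization e := he
  obtain ⟨W, hW, hsW, hWU⟩ := exists_isAffineOpen_mem_and_subset hU
  have : IsAffine W := hW
  have hj : ⊤ ≤ W.ι ⁻¹ᵁ U := fun x _ ↦ hWU x.2
  obtain ⟨d, -, -, hd⟩ := c.exists_isPullback_chartProj he W.ι hj hp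
  -- The point s excludes the zero ring, over which `natDegree` would be 0 instead of p.
  have : Nontrivial Γ(W, ⊤) := by
    have : Nonempty (⊤ : W.toScheme.Opens) := ⟨⟨⟨s, hsW⟩, trivial⟩⟩
    exact Scheme.component_nontrivial _ _
  exact (Scheme.Hom.finrank_of_isPullback _ _ _ _ hd ⟨s, hsW⟩).symm.trans
    ((rootScheme.finrank_proj (monic_congrPoly hp.pos _ _) _).trans
      (natDegree_congrPoly hp.pos _ _))

end Triple.CongruenceGroupScheme

open scoped MonObj

/-! ### The homomorphism κ to μ_p. -/

namespace Triple.CongruenceGroupScheme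

variable {p : ℕ} {S : Scheme.{u}} {X : Triple p S} {H : Scheme.{u}} [H.Over S]
  [GrpObj (H.asOver S)] (c : X.CongruenceGroupScheme H)

lemma oneAdd_points_comp {T T' : Over S} (a : T' ⟶ T) (h : T ⟶ H.asOver S) :
    X.oneAdd (c.points T' (a ≫ h)).1 = a.left.appTop (X.oneAdd (c.points T h).1) := by
  rw [c.points_comp, oneAdd_pullback, pb_top]

/-- The morphism `u ↦ 1 + λ ⊗ u` to `μ_p`. -/
def toMu (hp : p.Prime) : yonedaGrpObj (H.asOver S) ⟶ muFunctor p S where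
  app T := GrpCat.ofHom
    (MonoidHom.mk' (fun h : T.unop ⟶ H.asOver S ↦
      haveI : NeZero p := ⟨hp.ne_zero⟩
      (rootsOfUnity.mkOfPowEq (X.oneAdd (c.points T.unop h).1)
        (X.oneAdd_pow hp (c.points T.unop h).2.2) : rootsOfUnity p Γ(T.unop.left, ⊤)))
    fun h h' ↦ by
      ext
      simp [c.points_mul, oneAdd_star])
  naturality T T' a := by
    refine ConcreteCategory.hom_ext _ _ fun (h : T.unop ⟶ H.asOver S) ↦ ?_
    apply Subtype.ext
    apply Units.ext
    exact c.oneAdd_points_comp a.unop h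

lemma muValue_toMu (hp : p.Prime) {T : Over S} (h : T ⟶ H.asOver S) :
    muValue (c.toMu hp) h = X.oneAdd (c.points T h).1 := rfl

end Triple.CongruenceGroupScheme

/-! ### The comultiplication of an affine group scheme -/

section Comul

open MonoidalCategory CartesianMonoidalCategory Functor

open scoped Obj in
-- A monoidal functor preserves products of morphisms, and so does precomposition with the unit.
-- Applied to the base change adjunction, this computes the group law of a base change.
lemma homEquiv_mul {C D : Type*} [Category* C] [Category* D] [CartesianMonoidalCategory C]
    [CartesianMonoidalCategory D] {L : D ⥤ C} {F : C ⥤ D} [F.Monoidal] (adj : L ⊣ F)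
    {X : D} {M : C} [MonObj M] (f g : L.obj X ⟶ M) :
    adj.homEquiv X M (f * g) = adj.homEquiv X M f * adj.homEquiv X M g := by
  simp only [Adjunction.homEquiv_unit, Functor.map_mul, MonObj.comp_mul]

open scoped Obj in
lemma homEquiv_symm_mul {C D : Type*} [Category* C] [Category* D] [CartesianMonoidalCategory C]
    [CartesianMonoidalCategory D] {L : D ⥤ C} {F : C ⥤ D} [F.Monoidal] (adj : L ⊣ F)
    {X : D} {M : C} [MonObj M] (f g : X ⟶ F.obj M) :
    (adj.homEquiv X M).symm (f * g) = (adj.homEquiv X M).symm f * (adj.homEquiv X M).symm g := by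
  apply (adj.homEquiv X M).injective
  rw [homEquiv_mul]
  simp only [Equiv.apply_symm_apply]

/-- A point of a base change as a point of the given scheme. -/
def baseChangeHom {S H : Scheme.{u}} [H.Over S] {R : CommRingCat.{u}}
    (g : Spec R ⟶ S) {T : Over (Spec R)} (a : T ⟶ (baseChange H g).asOver (Spec R)) :
    Over.mk (T.hom ≫ g) ⟶ H.asOver S :=
  ((Over.mapPullbackAdj g).homEquiv T (H.asOver S)).symm a

/-- The points of a base change of a group scheme. -/
lemma baseChangeHom_mul {S H : Scheme.{u}} [H.Over S] [GrpObj (H.asOver S)] {R : CommRingCat.{u}}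
    (g : Spec R ⟶ S) {T : Over (Spec R)} (a b : T ⟶ (baseChange H g).asOver (Spec R)) :
    baseChangeHom g (a * b) = baseChangeHom g a * baseChangeHom g b :=
  homEquiv_symm_mul (Over.mapPullbackAdj g) (M := H.asOver S) a b

/-- The functions on an affine group scheme over `Spec R`, as a Hopf algebra. -/
def FunctionRing (R : CommRingCat.{u}) (G : Scheme.{u}) [G.Over (Spec R)]
    [GrpObj (G.asOver (Spec R))] [IsAffine G] : Type u := Γ(G, ⊤)

variable {R : CommRingCat.{u}} (G : Scheme.{u}) [G.Over (Spec R)] [GrpObj (G.asOver (Spec R))]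
  [IsAffine G]

instance : CommRing (FunctionRing R G) := inferInstanceAs (CommRing Γ(G, ⊤))

instance : HopfAlgebra R (FunctionRing R G) := inferInstanceAs (HopfAlgebra R Γ(G, ⊤))

/-- An affine group scheme is the spectrum of its Hopf algebra. -/
def isoAlgSpec : G.asOver (Spec R) ≅ (algSpec R).obj (op (.of R (FunctionRing R G))) :=
  G.isoSpec.asOver (Spec R)

/-- A morphism to an affine scheme over `Spec R` given by a homomorphism of algebras. -/
def affinePoint {B : Type u} [CommRing B] [Algebra R B] (f : FunctionRing R G →ₐ[R] B) :
    (algSpec R).obj (op (.of R B)) ⟶ G.asOver (Spec R) :=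
  (algSpec R).map (CommAlgCat.ofHom f).op ≫ (isoAlgSpec G).inv

/-- The comultiplication is by construction the group law transported through the full faithfulness
of Spec. The projections of Spec (A ⊗ A) are the points given by the two inclusions, and their
product in the group of points is the group law. -/
lemma affinePoint_comul :
    affinePoint G (Bialgebra.comulAlgHom R (FunctionRing R G)) =
      affinePoint G Algebra.TensorProduct.includeLeft *
        affinePoint G Algebra.TensorProduct.includeRight := by
  let A : (CommAlgCat R)ᵒᵖ := op (.of R (FunctionRing R G))
  let m : A ⊗ A ⟶ A := (CommAlgCat.ofHom (Bialgebra.comulAlgHom R (FunctionRing R G))).op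
  have h : m = algSpec.fullyFaithful.preimage (OplaxMonoidal.δ (algSpec R) A A ≫
      ((isoAlgSpec G).inv ⊗ₘ (isoAlgSpec G).inv) ≫ μ[G.asOver (Spec R)] ≫ (isoAlgSpec G).hom) := by
    apply Quiver.Hom.unop_inj
    ext x
    rfl
  have h' := congrArg (algSpec R).map h
  rw [algSpec.fullyFaithful.map_preimage] at h'
  have h'' : (algSpec R).map m ≫ (isoAlgSpec G).inv = OplaxMonoidal.δ (algSpec R) A A ≫
      ((isoAlgSpec G).inv ⊗ₘ (isoAlgSpec G).inv) ≫ μ[G.asOver (Spec R)] := by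
    rw [h']
    simp
  refine h''.trans ?_
  rw [Hom.mul_def, ← Category.assoc]
  congr 1
  ext1
  · simp
    rfl
  · simp
    rfl

end Comul

open scoped MonObj

/-! ### Functions on spectra of algebras -/

section AlgSpec

variable {R : CommRingCat.{u}}

/-- The spectrum of an `R`-algebra, as a scheme over `Spec R`. -/
abbrev specOver (R : CommRingCat.{u}) (B : Type u) [CommRing B] [Algebra R B] : Over (Spec R) :=
  (algSpec R).obj (op (.of R B))

variable {B B' : Type u} [CommRing B] [Algebra R B] [CommRing B'] [Algebra R B']

/-- The morphism of spectra defined by a homomorphism of algebras. -/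
def specOverMap (β : B →ₐ[R] B') : specOver R B' ⟶ specOver R B :=
  (algSpec R).map (CommAlgCat.ofHom β).op

/-- A function on the spectrum of `B` as an element of `B`. -/
def specOverFun (R : CommRingCat.{u}) (B : Type u) [CommRing B] [Algebra R B] :
    Γ((specOver R B).left, ⊤) →+* B :=
  (Scheme.ΓSpecIso (.of B)).hom.hom

lemma specOverFun_map (β : B →ₐ[R] B') (x : Γ((specOver R B).left, ⊤)) :
    specOverFun R B' (pb (specOverMap β).left ⊤ ⊤ (le_preimage_top _) x) =
      β (specOverFun R B x) := by
  rw [pb_top]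
  exact ConcreteCategory.congr_hom
    (Scheme.ΓSpecIso_naturality (CommRingCat.ofHom (β : B →+* B'))) x

end AlgSpec

section AffinePoint

lemma appTop_specMap_isoSpec_inv {V : Scheme.{u}} [IsAffine V] {B : CommRingCat.{u}}
    (f : Γ(V, ⊤) ⟶ B) :
    (Spec.map f ≫ V.isoSpec.inv).appTop ≫ (Scheme.ΓSpecIso B).hom = f := by
  rw [Scheme.Hom.comp_appTop, V.isoSpec_inv_appTop, Category.assoc, Scheme.ΓSpecIso_naturality,
    Iso.inv_hom_id_assoc]

variable {R : CommRingCat.{u}} (G : Scheme.{u}) [G.Over (Spec R)] [GrpObj (G.asOver (Spec R))]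
  [IsAffine G] {B B' : Type u} [CommRing B] [Algebra R B] [CommRing B'] [Algebra R B']

lemma affinePoint_comp (f : FunctionRing R G →ₐ[R] B) (β : B →ₐ[R] B') :
    affinePoint G (β.comp f) = specOverMap β ≫ affinePoint G f := by
  rw [affinePoint, affinePoint, specOverMap, ← Category.assoc, ← Functor.map_comp]
  rfl

lemma affinePoint_lift_comul (f₁ f₂ : FunctionRing R G →ₐ[R] B) :
    affinePoint G ((Algebra.TensorProduct.lift f₁ f₂ fun _ _ ↦ .all _ _).comp
      (Bialgebra.comulAlgHom R (FunctionRing R G))) = affinePoint G f₁ * affinePoint G f₂ := by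
  rw [affinePoint_comp, affinePoint_comul, MonObj.comp_mul, ← affinePoint_comp,
    ← affinePoint_comp]
  congr 2
  · exact Algebra.TensorProduct.lift_comp_includeLeft _ _ _
  · exact Algebra.TensorProduct.lift_comp_includeRight' _ _ _

lemma specOverFun_affinePoint (f : FunctionRing R G →ₐ[R] B) (x : Γ(G, ⊤)) :
    specOverFun R B ((affinePoint G f).left.appTop x) = f x := by
  exact ConcreteCategory.congr_hom (appTop_specMap_isoSpec_inv (V := G)
    (CommRingCat.ofHom (f : FunctionRing R G →+* B))) x

end AffinePoint

/-! ### Coordinates of points with values in algebras. -/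

namespace Triple.CongruenceGroupScheme

variable {p : ℕ} {S : Scheme.{u}} {X : Triple p S} {H : Scheme.{u}} [H.Over S]
  [GrpObj (H.asOver S)] (c : X.CongruenceGroupScheme H) {R : CommRingCat.{u}} (g : Spec R ⟶ S)
  [IsAffine (baseChange H g)]
  {B B' : Type u} [CommRing B] [Algebra R B] [CommRing B'] [Algebra R B']
  {U : S.Opens} (e : Γ(X.L, U))

/-- The coordinate of a point, given by a homomorphism of algebras, of a base change of the
congruence group scheme, with respect to a section of `L`. -/
def affineVal (hB : ⊤ ≤ ((specOver R B).hom ≫ g) ⁻¹ᵁ U)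
    (f : FunctionRing R (baseChange H g) →ₐ[R] B) : B :=
  specOverFun R B ((c.points _ (baseChangeHom g (affinePoint _ f))).1.val e hB)

variable (hB : ⊤ ≤ ((specOver R B).hom ≫ g) ⁻¹ᵁ U) (hB' : ⊤ ≤ ((specOver R B').hom ≫ g) ⁻¹ᵁ U)

lemma affineVal_comp (f : FunctionRing R (baseChange H g) →ₐ[R] B) (β : B →ₐ[R] B') :
    c.affineVal g e hB' (β.comp f) = β (c.affineVal g e hB f) := by
  let a : Over.mk ((specOver R B').hom ≫ g) ⟶ Over.mk ((specOver R B).hom ≫ g) :=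
    Over.homMk (specOverMap β).left ((Category.assoc _ _ _).symm.trans
      (congrArg (· ≫ g) (Over.w (specOverMap β))))
  have h : baseChangeHom g (affinePoint _ (β.comp f)) =
      a ≫ baseChangeHom g (affinePoint _ f) := by
    ext1
    rw [affinePoint_comp]
    exact Category.assoc _ _ _
  rw [affineVal, affineVal, h, c.points_comp]
  exact (congrArg _ (LinePoint.val_pullback _ e hB a hB')).trans (specOverFun_map β _)

/-- The coordinate of `λ` over the spectrum of an `R`-algebra. -/
def affineLam (X : Triple p S) {e : Γ(X.L, U)} (he : IsTrivialization e) : B :=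
  specOverFun R B (pb ((specOver R B).hom ≫ g) U ⊤ hB (X.lamCoeff he))

variable {e} (he : IsTrivialization e)

lemma map_affineLam (β : B →ₐ[R] B') :
    β (affineLam g hB X he) = affineLam g hB' X he := by
  rw [affineLam, affineLam, ← specOverFun_map, pb_pb _ _ _ _ ((specOver R B').hom ≫ g)]
  rw [← Category.assoc, Over.w]

/-- Points multiply through Δ (`affinePoint_lift_comul`), compatibly with base change
(`baseChangeHom_mul`), so this is the law ⋆ in coordinates. -/
lemma affineVal_comul (f₁ f₂ : FunctionRing R (baseChange H g) →ₐ[R] B) :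
    c.affineVal g e hB ((Algebra.TensorProduct.lift f₁ f₂ fun _ _ ↦ .all _ _).comp
      (Bialgebra.comulAlgHom R (FunctionRing R (baseChange H g)))) =
      c.affineVal g e hB f₁ + c.affineVal g e hB f₂ +
        affineLam g hB X he * (c.affineVal g e hB f₁ * c.affineVal g e hB f₂) := by
  have h := (congrArg (baseChangeHom g) (affinePoint_lift_comul (baseChange H g) f₁ f₂)).trans
    (baseChangeHom_mul g _ _)
  rw [affineVal, h, c.points_mul, X.val_star he hB]
  simp only [map_add, map_mul, ← mul_assoc]
  rfl

lemma eq_one_add_affineLam_mul (hp : p.Prime)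
    (f : FunctionRing R (baseChange H g) →ₐ[R] B) :
    f (coordinate (c.toMu hp) g) = 1 + affineLam g hB X he * c.affineVal g e hB f := by
  let a : Over.mk ((specOver R B).hom ≫ g) ⟶ Over.mk (pullback.fst (H ↘ S) g ≫ H ↘ S) :=
    Over.homMk (affinePoint _ f).left ((congrArg ((affinePoint _ f).left ≫ ·)
      pullback.condition).trans ((Category.assoc _ _ _).symm.trans
        (congrArg (· ≫ g) (Over.w (affinePoint _ f)))))
  have h := congrArg (specOverFun R B) ((c.oneAdd_points_comp a (baseChangePoint H g)).symm.trans
    (X.oneAdd_eq he hB (c.points _ (baseChangeHom g (affinePoint _ f))).1))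
  rw [map_add, map_one, map_mul] at h
  exact (specOverFun_affinePoint _ f _).symm.trans h

end Triple.CongruenceGroupScheme

/-- An algebra which is obtained, up to an isomorphism of the base ring, by adjoining a root of a
monic polynomial has a basis of powers of the root. -/
lemma exists_basis_of_adjoinRoot {K K' B : Type*} [CommRing K] [CommRing K'] [CommRing B]
    [Algebra K B] (σ : K' ≃+* K) {P : Polynomial K'} (hP : P.Monic) {n : ℕ}
    (hn : Nontrivial K' → P.natDegree = n) (ψ : AdjoinRoot P ≃+* B)
    (hψ : ∀ a, ψ (AdjoinRoot.of P a) = algebraMap K B (σ a)) :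
    ∃ b : Module.Basis (Fin n) K B, ∀ i, b i = ψ (AdjoinRoot.root P) ^ (i : ℕ) := by
  cases subsingleton_or_nontrivial K'
  -- Over the zero ring the degree says nothing, but every module is zero and any finite family in
  -- it is a basis.
  · have : Subsingleton K := σ.symm.injective.subsingleton
    have : Subsingleton B := Module.subsingleton K B
    exact ⟨.ofEquivFun ⟨0, 0, fun _ ↦ Subsingleton.elim _ _, fun _ ↦ Subsingleton.elim _ _⟩,
      fun _ ↦ Subsingleton.elim _ _⟩
  · let : Module K' B := Module.compHom B (σ : K' →+* K)
    let f : AdjoinRoot P ≃ₗ[K'] B :=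
      { ψ with
        map_smul' a x := by
          change ψ (a • x) = σ a • ψ x
          rw [Algebra.smul_def, Algebra.smul_def, map_mul]
          exact congrArg (· * ψ x) (hψ a) }
    have hσ (a : K') (x : B) : σ a • x = a • x := rfl
    refine ⟨(((AdjoinRoot.powerBasis' hP).basis.map f).mapCoeffs σ hσ).reindex
      (finCongr (hn inferInstance)), fun i ↦ ?_⟩
    rw [Module.Basis.reindex_apply, Module.Basis.mapCoeffs_apply, Module.Basis.map_apply,
      PowerBasis.basis_eq_pow]
    exact map_pow ψ _ _

/-! ### Bases of powers of the local coordinate. -/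

namespace Triple.CongruenceGroupScheme

variable {p : ℕ} {S : Scheme.{u}} {X : Triple p S} {H : Scheme.{u}} [H.Over S]
  [GrpObj (H.asOver S)] (c : X.CongruenceGroupScheme H)

lemma val_points_of_isPullback (hp : p.Prime) {U : S.Opens} {e : Γ(X.L, U)}
    (he : IsTrivialization e) {V : Scheme.{u}} [IsAffine V] {j : V ⟶ S} (hj : ⊤ ≤ j ⁻¹ᵁ U)
    {T : Over S} (h : T ⟶ H.asOver S) {q : T.left ⟶ V} (hT : ⊤ ≤ T.hom ⁻¹ᵁ U)
    (sq : IsPullback h.left q (H ↘ S) j) :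
    ∃ i : T.left ≅ X.chart he j hj, i.hom ≫ X.chartProj he j hj = q ∧
      pb i.hom ⊤ ⊤ (le_preimage_top _) (rootScheme.root _) = (c.points T h).1.val e hT := by
  obtain ⟨d, w, hd, sq'⟩ := c.exists_isPullback_chartProj he j hj hp
  let i := sq.isoIsPullback _ _ sq'
  have hi : i.hom ≫ d = h.left := sq.isoIsPullback_hom_fst _ _ sq'
  let a : T ⟶ Over.mk (X.chartProj he j hj ≫ j) := Over.homMk i.hom (by
    refine Eq.trans ?_ (Over.w h)
    rw [← hi]
    exact (congrArg (i.hom ≫ ·) w.symm).trans (Category.assoc _ _ _).symm)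
  have ha : h = a ≫ (Over.homMk d w : Over.mk (X.chartProj he j hj ≫ j) ⟶ H.asOver S) := by
    ext1
    exact hi.symm
  refine ⟨i, sq.isoIsPullback_hom_snd _ _ sq', ?_⟩
  rw [ha, c.points_comp, hd]
  refine Eq.trans ?_ (LinePoint.val_pullback _ e
    (top_le_preimage_of_comp j hj (X.chartProj he j hj) rfl) a hT).symm
  rw [chartPoint, LinePoint.val_ofVal]
  rfl

lemma exists_basis_of_isPullback (hp : p.Prime) {U : S.Opens} {e : Γ(X.L, U)}
    (he : IsTrivialization e) {K B : Type u} [CommRing K] [CommRing B] [Algebra K B]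
    {j : Spec (.of K) ⟶ S} (hj : ⊤ ≤ j ⁻¹ᵁ U) {f : Spec (.of B) ⟶ S} (h : Over.mk f ⟶ H.asOver S)
    (hT : ⊤ ≤ f ⁻¹ᵁ U)
    (sq : IsPullback h.left (Spec.map (CommRingCat.ofHom (algebraMap K B))) (H ↘ S) j) :
    ∃ b : Module.Basis (Fin p) K B, ∀ i,
      b i = (Scheme.ΓSpecIso (.of B)).hom ((c.points _ h).1.val e hT) ^ (i : ℕ) := by
  obtain ⟨i, hi, hi'⟩ := c.val_points_of_isPullback hp he hj h hT sq
  let P := X.chartPoly he j hj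
  obtain ⟨ψ, hψ⟩ : ∃ ψ : rootRing P ≅ .of B, i.hom = Spec.map ψ.hom :=
    ⟨⟨Spec.preimage i.hom, Spec.preimage i.inv, Spec.map_injective (by simp),
      Spec.map_injective (by simp)⟩, (Spec.map_preimage _).symm⟩
  have h₁ : ψ.hom (rootRing.root P) =
      (Scheme.ΓSpecIso (.of B)).hom ((c.points (Over.mk f) h).1.val e hT) := by
    have h := ConcreteCategory.congr_hom (Scheme.ΓSpecIso_inv_naturality ψ.hom) (rootRing.root P)
    rw [← hi', pb_top, hψ]
    exact ((congrArg (Scheme.ΓSpecIso (.of B)).hom h.symm).trans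
      (ConcreteCategory.congr_hom (Scheme.ΓSpecIso (.of B)).inv_hom_id _)).symm
  have h₂ : rootRing.of P ≫ ψ.hom = (Scheme.ΓSpecIso (.of K)).hom ≫
      CommRingCat.ofHom (algebraMap K B) := by
    have h := congrArg Scheme.Hom.appTop hi
    rw [hψ, Scheme.Hom.comp_appTop, rootScheme.appTop_proj, Category.assoc,
      ← Scheme.ΓSpecIso_inv_naturality, ← Category.assoc, Iso.comp_inv_eq] at h
    rw [h]
    exact Scheme.ΓSpecIso_naturality _
  obtain ⟨b, hb⟩ := exists_basis_of_adjoinRoot (n := p)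
    (Scheme.ΓSpecIso (.of K)).commRingCatIsoToRingEquiv (P := P) (monic_congrPoly hp.pos _ _)
    (fun _ ↦ natDegree_congrPoly hp.pos _ _) ψ.commRingCatIsoToRingEquiv
    fun a ↦ ConcreteCategory.congr_hom h₂ a
  exact ⟨b, fun i ↦ (hb i).trans (congrArg (· ^ (i : ℕ)) h₁)⟩

end Triple.CongruenceGroupScheme

instance isIso_isoAlgSpec_inv_left {R : CommRingCat.{u}} (G : Scheme.{u}) [G.Over (Spec R)]
    [GrpObj (G.asOver (Spec R))] [IsAffine G] : IsIso (isoAlgSpec (R := R) G).inv.left :=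
  inferInstanceAs (IsIso ((Over.forget (Spec R)).map (isoAlgSpec (R := R) G).inv))

/-! ### Verification of the norm condition. -/

namespace Triple.CongruenceGroupScheme

variable {p : ℕ} {S : Scheme.{u}} {X : Triple p S} {H : Scheme.{u}} [H.Over S]
  [GrpObj (H.asOver S)] (c : X.CongruenceGroupScheme H) {R : CommRingCat.{u}} (g : Spec R ⟶ S)
  [IsAffine (baseChange H g)]

/-- Three cartesian squares are pasted: Spec (K ⊗ A) over Spec A, the isomorphism of Spec A with
H_R, and H_R over H. -/
lemma isPullback_affinePoint (K : Type u) [CommRing K] [Algebra R K] :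
    IsPullback (baseChangeHom g (affinePoint (baseChange H g)
        (Algebra.TensorProduct.includeRight (A := K)))).left
      (Spec.map (CommRingCat.ofHom (algebraMap K (K ⊗[R] FunctionRing R (baseChange H g)))))
      (H ↘ S) (Spec.map (CommRingCat.ofHom (algebraMap R K)) ≫ g) := by
  have h₁ : IsPullback (pullback.fst (H ↘ S) g) (pullback.snd (H ↘ S) g) (H ↘ S) g :=
    .of_hasPullback _ _
  have := isIso_isoAlgSpec_inv_left (R := R) (baseChange H g)
  have h₂ : IsPullback (isoAlgSpec (baseChange H g)).inv.left
      (Spec.map (CommRingCat.ofHom (algebraMap R (FunctionRing R (baseChange H g)))))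
      (pullback.snd (H ↘ S) g) (𝟙 _) :=
    .of_horiz_isIso ⟨(Over.w (isoAlgSpec (baseChange H g)).inv).trans (Category.comp_id _).symm⟩
  have h₃ := isPullback_SpecMap_of_isPushout _ _ _ _
    (CommRingCat.isPushout_tensorProduct R K (FunctionRing R (baseChange H g)))
  have h := h₃.flip.paste_horiz (h₂.paste_horiz h₁)
  rw [Category.id_comp] at h
  exact h

/-- The element x is the coordinate of the tautological point A → K ⊗ A. Its images under Δ and the
two inclusions are the coordinates of three points with values in K ⊗ (A ⊗ A), the first being the
product of the other two, so `affineVal_comul` applies. -/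
lemma hasCoordinate (hp : p.Prime) {U : S.Opens} {e : Γ(X.L, U)} (he : IsTrivialization e)
    (K : Type u) [CommRing K] [Algebra R K]
    (hK : ⊤ ≤ (Spec.map (CommRingCat.ofHom (algebraMap R K)) ≫ g) ⁻¹ᵁ U) :
    HasCoordinate R (A := FunctionRing R (baseChange H g)) K p (coordinate (c.toMu hp) g) := by
  let A := FunctionRing R (baseChange H g)
  have hB (B : Type u) [CommRing B] [Algebra R B] (β : K →ₐ[R] B) :
      ⊤ ≤ ((specOver R B).hom ≫ g) ⁻¹ᵁ U :=
    top_le_preimage_of_comp _ hK (specOverMap β).left ((Category.assoc _ _ _).symm.trans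
      (congrArg (· ≫ g) (Over.w (specOverMap β))))
  have h₁ := hB (K ⊗[R] A) Algebra.TensorProduct.includeLeft
  have h₂ := hB (K ⊗[R] (A ⊗[R] A)) Algebra.TensorProduct.includeLeft
  let l : K := affineLam g hK X he
  have hl₁ : algebraMap K (K ⊗[R] A) l = affineLam g h₁ X he :=
    map_affineLam (g := g) (hB := hK) h₁ he
      (Algebra.TensorProduct.includeLeft : K →ₐ[R] K ⊗[R] A)
  have hl₂ : algebraMap K (K ⊗[R] (A ⊗[R] A)) l = affineLam g h₂ X he :=
    map_affineLam (g := g) (hB := hK) h₂ he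
      (Algebra.TensorProduct.includeLeft : K →ₐ[R] K ⊗[R] (A ⊗[R] A))
  let x : K ⊗[R] A := c.affineVal g e h₁ Algebra.TensorProduct.includeRight
  have hx (f : A →ₐ[R] A ⊗[R] A) :
      Algebra.TensorProduct.map (AlgHom.id K K) f x =
        c.affineVal g e h₂ (Algebra.TensorProduct.includeRight.comp f) := by
    refine (c.affineVal_comp g e h₁ h₂ _
      ((Algebra.TensorProduct.map (AlgHom.id K K) f).restrictScalars R)).symm.trans ?_
    congr 1
  obtain ⟨b, hb⟩ := c.exists_basis_of_isPullback hp he hK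
    (baseChangeHom g (affinePoint (baseChange H g) (Algebra.TensorProduct.includeRight (A := K))))
    h₁ (isPullback_affinePoint g K)
  refine ⟨l, x, b, hb, ?_, ?_⟩
  · rw [Algebra.smul_def, hl₁]
    exact c.eq_one_add_affineLam_mul g h₁ he hp Algebra.TensorProduct.includeRight
  · rw [hx, hx, hx, Algebra.smul_def, hl₂, ← c.affineVal_comul g h₂ he]
    congr 2
    ext <;> simp

/-- A finite algebra of finite presentation is finitely presented as a module, and a flat module of
finite presentation is projective. -/
lemma finite_projective_functionRing (c : X.CongruenceGroupScheme H) (hp : p.Prime) :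
    Module.Finite R (FunctionRing R (baseChange H g)) ∧
      Module.Projective R (FunctionRing R (baseChange H g)) := by
  have h := c.isFiniteLocallyFreeOfOrder hp
  have := h.isFinite
  have := h.flat
  have := h.locallyOfFinitePresentation
  let f := Spec.map (CommRingCat.ofHom (algebraMap R (FunctionRing R (baseChange H g))))
  let i : Spec (.of (FunctionRing R (baseChange H g))) ⟶ pullback (H ↘ S) g :=
    (isoAlgSpec (R := R) (baseChange H g)).inv.left
  have hi : IsIso i := isIso_isoAlgSpec_inv_left (R := R) (baseChange H g)
  have hf : i ≫ pullback.snd (H ↘ S) g = f := Over.w (isoAlgSpec (baseChange H g)).inv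
  have h₁ : IsFinite f := by rw [← hf]; infer_instance
  have h₂ : Flat f := by rw [← hf]; infer_instance
  have h₃ : LocallyOfFinitePresentation f := by rw [← hf]; infer_instance
  have h₁ := RingHom.finite_algebraMap.1 ((IsFinite.SpecMap_iff _).1 h₁)
  have h₂ := RingHom.flat_algebraMap_iff.1 (Flat.SpecMap_iff.1 h₂)
  have h₃ := RingHom.finitePresentation_algebraMap.1
    ((LocallyOfFinitePresentation.SpecMap_iff _).1 h₃)
  have : Module.FinitePresentation R (FunctionRing R (baseChange H g)) :=
    Module.FinitePresentation.of_finite_of_finitePresentation R _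
  exact ⟨h₁, Module.Flat.projective_of_finitePresentation⟩

lemma dualNormIsProduct (hp : p.Prime) :
    DualNormIsProduct p R (FunctionRing R (baseChange H g)) (coordinate (c.toMu hp) g) := by
  obtain ⟨_, _⟩ := c.finite_projective_functionRing g hp
  let s : Set R := {r | ∃ (U : S.Opens) (e : Γ(X.L, U)), IsTrivialization e ∧
    ⊤ ≤ (Spec.map (CommRingCat.ofHom (algebraMap R (Localization.Away r))) ≫ g) ⁻¹ᵁ U}
  refine dualNormIsProduct_of_local (s := s) _ ?_ fun r ⟨U, e, he, hr⟩ ↦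
    c.hasCoordinate g hp he _ hr
  -- Were all these r in a maximal ideal m, a basic neighbourhood of m in the preimage of a
  -- trivializing open around g(m) would give such an r outside m.
  by_contra h
  obtain ⟨m, hm, hsm⟩ := Ideal.exists_le_maximal _ h
  let x : PrimeSpectrum R := ⟨m, hm.isPrime⟩
  obtain ⟨U, hU, e, he⟩ := X.isInvertible (g x)
  obtain ⟨_, ⟨_, ⟨r, rfl⟩, rfl⟩, hxr, hrU⟩ :=
    PrimeSpectrum.isBasis_basic_opens.exists_subset_of_mem_open
      (a := x) (u := (g ⁻¹ᵁ U : (Spec R).Opens).carrier) hU (g ⁻¹ᵁ U).2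
  refine hxr (hsm (Ideal.subset_span ⟨U, e, he, fun y _ ↦ hrU ?_⟩))
  exact (PrimeSpectrum.localization_away_comap_range (Localization.Away r) r).subset ⟨y, rfl⟩

lemma isCogenerator (c : X.CongruenceGroupScheme H) (hp : p.Prime) :
    IsCogenerator p (c.toMu hp) where
  isFiniteLocallyFree := c.isFiniteLocallyFreeOfOrder hp
  isFullSetOfSections g :=
    haveI := isAffine_baseChange (c.isFiniteLocallyFreeOfOrder hp) g
    c.dualNormIsProduct g hp

end Triple.CongruenceGroupScheme

end CongruenceGroup

end

theorem lemmaA8 (p : ℕ) (hp : p.Prime) (S : Scheme.{u}) (X : CongruenceGroup.Triple p S) :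
    -- the congruence group scheme exists
    (∃ (H : Scheme.{u}) (_ : H.Over S) (_ : GrpObj (H.asOver S)),
      Nonempty (X.CongruenceGroupScheme H)) ∧
    -- and `1 + λ` defines on it a morphism of group schemes to `μ_p` which is a cogenerator
    ∀ (H : Scheme.{u}) [H.Over S] [GrpObj (H.asOver S)] (c : X.CongruenceGroupScheme H),
      ∃ κ : yonedaGrpObj (H.asOver S) ⟶ CongruenceGroup.muFunctor p S,
        (∀ (T : Over S) (h : T ⟶ H.asOver S),
          CongruenceGroup.muValue κ h = X.oneAdd (c.points T h).1) ∧
        CongruenceGroup.IsCogenerator p κ :=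
  ⟨X.exists_congruenceGroupScheme hp, fun _ _ _ c ↦
    ⟨c.toMu hp, fun _ h ↦ c.muValue_toMu hp h, c.isCogenerator hp⟩⟩
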